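/- **Terminology.** Let $E$ be a Euclidean space (a finite-dimensional real inner product space). A set $X\subset E$ is a $C^{2}$-manifold around a point $z\in X$ if there is a map $F$ from $E$ to some $\mathbb R^m$, $C^{2}$-smooth near $z$ and with surjective derivative $DF(z)$, such that $X$ and $F^{-1}(0)$ coincide near $z$. For $x\in X$ near $z$ (including $x=z$), the tangent and normal spaces are $T_X(x)=\mathrm{Null}(DF(x))$ and $N_X(x)=\mathrm{Range}(DF(x)^*)$; they do not depend on the choice of $F$. Two such manifolds $X,Y$ intersect transversally at $z$ if $N_X(z)\cap N_Y(z)=\{0\}$. A map $P:X\to Y$ is $C^2$-smooth and of constant rank near $z$ if near $z$ it is the restriction to $X$ of a map that is $C^2$ near $z$ in $E$, and the rank of its derivative on $T_X(x)$ is the same for all $x\in X$ near $z$. For a set $A$, $\mathrm{Proj}_A(y)$ denotes the set of points of $A$ nearest to $y$, and also its element when it is a singleton. $\mathcal N(z)$ denotes the set of (not necessarily open) neighborhoods of $z$. **Theorem (active set method for manifold intersection).** Let $z$ be an isolated point of the intersection of two $C^2$-manifolds $X$ and $Y$ around $z$ in $E$, and suppose that the intersection is transversal at $z$. Let $P:X\to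 Y$ be a map with $P(z)=z$ that is $C^2$-smooth and of constant rank near $z$. Then there is $W_0\in\mathcal N(z)$ such that for every $W\in\mathcal N(z)$ with $W\subset W_0$ the following hold. (a) The image $M=P(X\cap W)\subset Y$ is a $C^2$-manifold around $z$. (b) There is a Lipschitz map $S:Y\cap W\to M$ with $S(z)=z$. Moreover, one can choose $S=\mathrm{Proj}_M$ near $z$: for some $V\in\mathcal N(z)$ with $V\subset W$, $\mathrm{Proj}_M(y)$ is a singleton for every $y\in Y\cap V$, and $\mathrm{Proj}_M:Y\cap V\to M$ is Lipschitz and fixes $z$. If $W$ is a closed ball centered at $z$, this holds with $V=W$. (c) There is a Lipschitz map $Q:M\cap W\to X$ with $Q(z)=z$ and $P(Q(w))=w$ for all $w\in M\cap W$. In particular one can choose $Q(w)=\mathrm{Proj}_{P^{-1}(w)}(w)$: this is a singleton for every $w\in M\cap W$, and the resulting map has these properties. (d) For every $x\in X\cap W$, the set $(x+T_X(x))\cap(Y\cap W)$ has at most one point, and for every $x\in X$ sufficiently near $z$ it has exactly one, denoted $y(x)$. If $W$ is an open or closed ball centered at $z$, it has exactly one point for every $x\in X\cap W$. (e) Let $V\in\mathcal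 N(z)$ with $V\subset W$, let $S:Y\cap V\to M$ be Lipschitz with $S(z)=z$, and let $Q$ be any map as in the first sentence of (c). Then there are $\delta>0$ and $C\in\mathbb R$ such that, from any $x_0\in X$ with $|x_0-z|<\delta$, the iteration $x_{k+1}=Q\big(S(y(x_k))\big)$ is well defined (for all $k$: $x_k\in X\cap W$, the point $y(x_k)$ exists and lies in $Y\cap V$, and $S(y(x_k))\in M\cap W$) and converges quadratically to $z$: $x_k\to z$ and $|x_{k+1}-z|\le C|x_k-z|^2$ for all $k$. -/

import Mathlib

open Set Filter Topology Metric
open scoped NNReal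

namespace ManifoldIntersection

variable {E : Type*} [NormedAddCommGroup E] [InnerProductSpace ℝ E] [FiniteDimensional ℝ E]

/-- `F : E → ℝᵐ` is a `C^(r)` system of local equations for the set `X` around `x`: it is
`C^(r)` near `x`, its derivative at `x` is surjective, and, near `x`, the set `X` coincides with
`F⁻¹(0)`. Used for `r ≥ 1`. -/
structure IsLocalEquation (r : ℕ) (X : Set E) (x : E) {m : ℕ}
    (F : E → EuclideanSpace ℝ (Fin m)) : Prop where
  contDiffAt : ContDiffAt ℝ r F x
  surjective : Function.Surjective (fderiv ℝ F x)
  eventually_iff : ∀ᶠ y in 𝓝 x, y ∈ X ↔ F y = 0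

/-- The set `X` is a `C^(r)`-manifold around its point `x`. -/
def IsManifoldAround (r : ℕ) (X : Set E) (x : E) : Prop :=
  x ∈ X ∧ ∃ (m : ℕ) (F : E → EuclideanSpace ℝ (Fin m)), IsLocalEquation r X x F

/-- The tangent space `T_X(x) = Null (DF(x))`, where `F` is any `C^(1)` system of local equations
for `X` around `x`; see `tangentSpace_eq` for the independence of `F`. -/
noncomputable def tangentSpace (X : Set E) (x : E) : Submodule ℝ E :=
  ⨆ (m : ℕ) (F : E → EuclideanSpace ℝ (Fin m)) (_ : IsLocalEquation 1 X x F),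
    (fderiv ℝ F x).toLinearMap.ker

/-- The normal space `N_X(x) = Range (DF(x)^*)`, where `F` is any `C^(1)` system of local equations
for `X` around `x`; see `normalSpace_eq` for the independence of `F`. -/
noncomputable def normalSpace (X : Set E) (x : E) : Submodule ℝ E :=
  ⨆ (m : ℕ) (F : E → EuclideanSpace ℝ (Fin m)) (_ : IsLocalEquation 1 X x F),
    (ContinuousLinearMap.adjoint (fderiv ℝ F x)).toLinearMap.range

/-- The map `P`, considered on the manifold `X` only, is `C^(r)`-smooth and of constant rank near
the point `z` of `X`: near `z` it is the restriction to `X` of a `C^(r)` map `P'` of the ambient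
space, and the rank of its derivative `T_X(x) → E`, the restriction of `DP'(x)` to `T_X(x)`, is
the same for all `x ∈ X` near `z`. -/
def IsSmoothOfConstantRankNear (r : ℕ) (X : Set E) (P : E → E) (z : E) : Prop :=
  ∃ P' : E → E, ContDiffAt ℝ r P' z ∧ (∀ᶠ x in 𝓝[X] z, P x = P' x) ∧
    ∃ k : ℕ, ∀ᶠ x in 𝓝[X] z,
      Module.finrank ℝ ((tangentSpace X x).map (fderiv ℝ P' x).toLinearMap) = k

/-- `Proj_A(y)`: the set of points of `A` nearest to `y`. -/
def nearestPoints (A : Set E) (y : E) : Set E :=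
  {p | p ∈ A ∧ ∀ q ∈ A, dist y p ≤ dist y q}

/-- `f` restricts to a Lipschitz map `A → B` that fixes the point `z`. -/
def IsLipschitzMapFixing (A B : Set E) (z : E) (f : E → E) : Prop :=
  MapsTo f A B ∧ (∃ K : ℝ≥0, LipschitzOnWith K f A) ∧ f z = z

theorem IsLocalEquation.ker_le {X : Set E} {x : E} (hx : x ∈ X) {m n : ℕ}
    {F : E → EuclideanSpace ℝ (Fin m)} {G : E → EuclideanSpace ℝ (Fin n)}
    (hF : IsLocalEquation 1 X x F) (hG : IsLocalEquation 1 X x G) :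
    (fderiv ℝ F x).toLinearMap.ker ≤ (fderiv ℝ G x).toLinearMap.ker := by
  have hsF : HasStrictFDerivAt F (fderiv ℝ F x) x :=
    hF.contDiffAt.hasStrictFDerivAt (by norm_num)
  have hsG : HasStrictFDerivAt G (fderiv ℝ G x) x :=
    hG.contDiffAt.hasStrictFDerivAt (by norm_num)
  have hr : (fderiv ℝ F x).range = ⊤ := LinearMap.range_eq_top.2 hF.surjective
  have hx0 : F x = 0 := (hF.eventually_iff.self_of_nhds).1 hx
  set φ := hsF.implicitFunction F (fderiv ℝ F x) hr (F x) with hφ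
  have hd : HasStrictFDerivAt φ (fderiv ℝ F x).ker.subtypeL 0 := hsF.to_implicitFunction hr
  have h0 : φ 0 = x := by
    exact hsF.implicitFunction_apply_image hr
  have hcont : Tendsto φ (𝓝 0) (𝓝 x) := by
    have := hd.hasFDerivAt.continuousAt.tendsto
    rwa [h0] at this
  have hpair : Tendsto (fun t : (fderiv ℝ F x).ker => (F x, t)) (𝓝 0) (𝓝 (F x, 0)) :=
    tendsto_const_nhds.prodMk_nhds tendsto_id
  have h1 : ∀ᶠ t in 𝓝 (0 : (fderiv ℝ F x).ker), F (φ t) = F x :=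
    hpair.eventually (hsF.map_implicitFunction_eq hr)
  have h2 : (fun t => G (φ t)) =ᶠ[𝓝 0] fun _ => (0 : EuclideanSpace ℝ (Fin n)) := by
    filter_upwards [h1, hcont.eventually hF.eventually_iff, hcont.eventually hG.eventually_iff]
      with t a b c
    exact c.1 (b.2 (a.trans hx0))
  have h3 : HasFDerivAt (fun t => G (φ t))
      ((fderiv ℝ G x).comp (fderiv ℝ F x).ker.subtypeL) 0 := by
    have hg : HasFDerivAt G (fderiv ℝ G x) (φ 0) := by rw [h0]; exact hsG.hasFDerivAt
    exact hg.comp 0 hd.hasFDerivAt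
  have h4 := h3.unique ((hasFDerivAt_const (0 : EuclideanSpace ℝ (Fin n)) _).congr_of_eventuallyEq h2)
  intro v hv
  have := congrArg (fun L => L ⟨v, hv⟩) h4
  simpa using this

theorem tangentSpace_eq {X : Set E} {x : E} (hx : x ∈ X) {m : ℕ}
    {F : E → EuclideanSpace ℝ (Fin m)} (hF : IsLocalEquation 1 X x F) :
    tangentSpace X x = (fderiv ℝ F x).toLinearMap.ker := by
  apply le_antisymm
  · exact iSup_le fun _ => iSup_le fun _ => iSup_le fun hG => hG.ker_le hx hF
  · exact le_iSup_of_le m (le_iSup_of_le F (le_iSup_of_le hF le_rfl))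

theorem range_adjoint_eq {m : ℕ} (L : E →L[ℝ] EuclideanSpace ℝ (Fin m)) :
    (ContinuousLinearMap.adjoint L).toLinearMap.range = L.toLinearMap.kerᗮ := by
  have h := ContinuousLinearMap.orthogonal_range (ContinuousLinearMap.adjoint L)
  rw [ContinuousLinearMap.adjoint_adjoint] at h
  rw [← Submodule.orthogonal_orthogonal (ContinuousLinearMap.adjoint L).toLinearMap.range]
  exact congrArg _ h

theorem normalSpace_eq {X : Set E} {x : E} (hx : x ∈ X) {m : ℕ}
    {F : E → EuclideanSpace ℝ (Fin m)} (hF : IsLocalEquation 1 X x F) :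
    normalSpace X x = (ContinuousLinearMap.adjoint (fderiv ℝ F x)).toLinearMap.range := by
  apply le_antisymm
  · refine iSup_le fun _ => iSup_le fun _ => iSup_le fun hG => ?_
    rw [range_adjoint_eq, range_adjoint_eq]
    exact Submodule.orthogonal_le (hF.ker_le hx hG)
  · exact le_iSup_of_le m (le_iSup_of_le F (le_iSup_of_le hF le_rfl))

end ManifoldIntersection

/-!
The constant rank theorem (`exists_isAdaptedChart`) provides `C²` coordinates `(a, b)` on `X`
around `z` in which `P` reads `(a, b) ↦ ψ a`, where `ψ` parametrizes a graph over a subspace `R`.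
So, near `z`, the image `M = P (X ∩ W)` is that graph whatever `W` is, which makes it a manifold
(`IsUniformChart.isManifoldAround_image`).

Nearest points of `M` are controlled without derivatives. If `W` is a ball of radius `ε`, then any
two points `p`, `q` of `M` have their midpoint in `M` up to an error `c |p - q|²`, where `c` does
not depend on `ε`: take the point of `X` whose coordinates are the mean of those of preimages of
`p` and `q`; by uniform convexity of the ball it still lies in the ball, if `ε` is small
(`IsUniformChart.isAlmostMidpointConvex_image`). The parallelogram law turns this into quadratic
growth of the squared distance away from a nearest point, hence into uniqueness and Lipschitz
dependence (`IsAlmostMidpointConvex.exists_projection`). A general `W` contains a small closed ball,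
and passing to it does not change `M` near `z`.

For the fibers of `P`, two first-order optimality conditions are subtracted; the directions along
the fibers vary in a Lipschitz way, so the variation of the nearest points is controlled by that of
the base points (`IsUniformChart.dist_nearestPoints_fiber_le`).

Since the intersection is isolated and transversal, the derivatives at `z` of the equations `F` of
`X` and `H` of `Y` form together an isomorphism. For `x ∈ X` near `z`, the map
`y ↦ (DF(x)(y - x), H y)` is uniformly close to it, so it has exactly one zero `y(x)` near `z`, and
Taylor expansion of `F` gives `|y(x) - z| ≤ C |x - z|²` (`exists_tangent_intersection`). Composing
with Lipschitz maps that fix `z` keeps this bound, and the iteration converges quadratically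
(`exists_quadratic_convergence`).
-/

namespace ManifoldIntersection

/-! ### Quantitative consequences of `C²` smoothness -/

/-- On the set `s`, the map `f` has a `C`-Lipschitz derivative, and the estimates that this entails
on a bounded convex set hold with the same constant `C`: first-order Taylor expansion, Lipschitz
continuity, and the error made when `f` is interchanged with taking midpoints. -/
structure QuadraticControl {A B : Type*} [NormedAddCommGroup A] [NormedSpace ℝ A]
    [NormedAddCommGroup B] [NormedSpace ℝ B] (f : A → B) (s : Set A) (C : ℝ) : Prop where
  differentiableAt : ∀ x ∈ s, DifferentiableAt ℝ f x
  fderiv_sub_le : ∀ x ∈ s, ∀ y ∈ s, ‖fderiv ℝ f x - fderiv ℝ f y‖ ≤ C * ‖x - y‖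
  taylor : ∀ x ∈ s, ∀ y ∈ s, ‖f x - f y - fderiv ℝ f y (x - y)‖ ≤ C * ‖x - y‖ ^ 2
  lipschitz : ∀ x ∈ s, ∀ y ∈ s, ‖f x - f y‖ ≤ C * ‖x - y‖
  midpoint : ∀ x ∈ s, ∀ y ∈ s,
    ‖f (midpoint ℝ x y) - midpoint ℝ (f x) (f y)‖ ≤ C * ‖x - y‖ ^ 2

section Calculus

variable {A B : Type*} [NormedAddCommGroup A] [NormedSpace ℝ A]
  [NormedAddCommGroup B] [NormedSpace ℝ B]

theorem QuadraticControl.mono {f : A → B} {s t : Set A} {C : ℝ} (h : QuadraticControl f s C)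
    (hts : t ⊆ s) : QuadraticControl f t C where
  differentiableAt x hx := h.differentiableAt x (hts hx)
  fderiv_sub_le x hx y hy := h.fderiv_sub_le x (hts hx) y (hts hy)
  taylor x hx y hy := h.taylor x (hts hx) y (hts hy)
  lipschitz x hx y hy := h.lipschitz x (hts hx) y (hts hy)
  midpoint x hx y hy := h.midpoint x (hts hx) y (hts hy)

theorem exists_quadraticControl {f : A → B} {a : A} (hf : ContDiffAt ℝ 2 f a) :
    ∃ C > 0, ∃ r > 0, QuadraticControl f (ball a r) C := by
  have hd : ∀ᶠ x in 𝓝 a, DifferentiableAt ℝ f x := by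
    filter_upwards [hf.eventually (by simp)] with x hx
    exact hx.differentiableAt (by norm_num)
  obtain ⟨K, t, ht, hK⟩ := (hf.fderiv_right (m := 1) (by norm_num)).exists_lipschitzOnWith
  obtain ⟨K', t', ht', hK'⟩ := (hf.of_le (m := 1) (by norm_num)).exists_lipschitzOnWith
  obtain ⟨r, hr, hball⟩ := Metric.mem_nhds_iff.1 (inter_mem (inter_mem ht ht') hd)
  set C : ℝ := K + K' + 1 with hC
  have hKC : (K : ℝ) ≤ C := by have := K'.coe_nonneg; linarith
  have hKC' : (K' : ℝ) ≤ C := by have := K.coe_nonneg; linarith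
  have hC0 : 0 < C := by have := K.coe_nonneg; have := K'.coe_nonneg; linarith
  have hfd : ∀ x ∈ ball a r, ∀ y ∈ ball a r, ‖fderiv ℝ f x - fderiv ℝ f y‖ ≤ C * ‖x - y‖ := by
    intro x hx y hy
    have := hK.dist_le_mul x (hball hx).1.1 y (hball hy).1.1
    rw [dist_eq_norm, dist_eq_norm] at this
    exact this.trans (by gcongr)
  have htay : ∀ x ∈ ball a r, ∀ y ∈ ball a r,
      ‖f x - f y - fderiv ℝ f y (x - y)‖ ≤ C * ‖x - y‖ ^ 2 := by
    intro x hx y hy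
    have hseg : segment ℝ y x ⊆ ball a r := (convex_ball a r).segment_subset hy hx
    have := (convex_segment y x).norm_image_sub_le_of_norm_fderiv_le' (f := f)
      (φ := fderiv ℝ f y) (C := C * ‖x - y‖) (fun u hu => (hball (hseg hu)).2)
      (fun u hu => (hfd u (hseg hu) y hy).trans ?_) (left_mem_segment ℝ y x)
      (right_mem_segment ℝ y x)
    · rwa [mul_assoc, ← sq] at this
    · gcongr
      obtain ⟨θ, hθ, rfl⟩ := segment_eq_image' ℝ y x ▸ hu
      rw [add_sub_cancel_left, norm_smul, Real.norm_of_nonneg hθ.1]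
      exact mul_le_of_le_one_left (norm_nonneg _) hθ.2
  refine ⟨C, hC0, r, hr, fun x hx => (hball hx).2, hfd, htay, fun x hx y hy => ?_,
    fun x hx y hy => ?_⟩
  · have := hK'.dist_le_mul x (hball hx).1.2 y (hball hy).1.2
    rw [dist_eq_norm, dist_eq_norm] at this
    exact this.trans (by gcongr)
  · -- the linear terms of the two expansions at the midpoint cancel
    set m := midpoint ℝ x y with hm
    have hmb : m ∈ ball a r := (convex_ball a r).segment_subset hx hy (midpoint_mem_segment x y)
    have h1 : x - m = (2⁻¹ : ℝ) • (x - y) := by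
      rw [hm, midpoint_eq_smul_add, invOf_eq_inv]; module
    have h2 : y - m = -((2⁻¹ : ℝ) • (x - y)) := by
      rw [hm, midpoint_eq_smul_add, invOf_eq_inv]; module
    have e1 := htay x hx m hmb
    have e2 := htay y hy m hmb
    rw [h1] at e1
    rw [h2, map_neg, norm_neg] at e2
    have hn : ‖(2⁻¹ : ℝ) • (x - y)‖ = 2⁻¹ * ‖x - y‖ := by
      rw [norm_smul, Real.norm_of_nonneg (by norm_num)]
    rw [hn] at e1 e2
    have key : f m - midpoint ℝ (f x) (f y) =
        (-(2⁻¹ : ℝ)) • ((f x - f m - fderiv ℝ f m ((2⁻¹ : ℝ) • (x - y))) +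
          (f y - f m - -(fderiv ℝ f m ((2⁻¹ : ℝ) • (x - y))))) := by
      rw [midpoint_eq_smul_add, invOf_eq_inv]; module
    rw [key, norm_smul, norm_neg, Real.norm_of_nonneg (by norm_num)]
    have := norm_add_le (f x - f m - fderiv ℝ f m ((2⁻¹ : ℝ) • (x - y)))
          (f y - f m - -(fderiv ℝ f m ((2⁻¹ : ℝ) • (x - y))))
    have hpos : 0 ≤ C * ‖x - y‖ ^ 2 := by positivity
    nlinarith

theorem eventually_surjective_fderiv [FiniteDimensional ℝ B] [CompleteSpace A]
    {f : A → B} {a : A} (hf : ContDiffAt ℝ 1 f a)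
    (hs : Function.Surjective (fderiv ℝ f a)) :
    ∀ᶠ x in 𝓝 a, Function.Surjective (fderiv ℝ f x) := by
  have hc : ContinuousAt (fderiv ℝ f) a :=
    (hf.fderiv_right (m := 0) (by norm_num)).continuousAt
  have ho := isOpen_setOfPred_nat_le_rank (𝕜 := ℝ) (E := A) (F := B) (Module.finrank ℝ B)
  have hmem : fderiv ℝ f a ∈ {g : A →L[ℝ] B | (Module.finrank ℝ B : Cardinal) ≤
      (g : A →ₗ[ℝ] B).rank} := by
    rw [mem_ofPred_eq, LinearMap.rank, LinearMap.range_eq_top.2 hs, rank_top, Module.finrank_eq_rank]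
  filter_upwards [hc.eventually (ho.mem_nhds hmem)] with x hx
  rw [LinearMap.rank, ← Module.finrank_eq_rank, Nat.cast_le] at hx
  exact LinearMap.range_eq_top.1
    (Submodule.eq_top_of_finrank_eq (le_antisymm (Submodule.finrank_le _) hx))

end Calculus

/-! ### Nearest points of almost midpoint-convex sets -/

section NearestPoints

variable {E : Type*} [NormedAddCommGroup E] [InnerProductSpace ℝ E]

theorem norm_sub_midpoint_sq (y p q : E) :
    ‖y - midpoint ℝ p q‖ ^ 2 = (‖y - p‖ ^ 2 + ‖y - q‖ ^ 2) / 2 - ‖p - q‖ ^ 2 / 4 := by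
  have h := parallelogram_law_with_norm ℝ (y - p) (y - q)
  have h1 : (y - p) + (y - q) = (2 : ℝ) • (y - midpoint ℝ p q) := by
    rw [midpoint_eq_smul_add, invOf_eq_inv]; module
  have h2 : (y - p) - (y - q) = -(p - q) := by abel
  rw [h1, h2, norm_neg, norm_smul, Real.norm_of_nonneg (by norm_num)] at h
  nlinarith

/-- Every two points of `M` have their midpoint in `M`, up to an error that is at most `c` times
the square of their distance. -/
def IsAlmostMidpointConvex (c : ℝ) (M : Set E) : Prop :=
  ∀ p ∈ M, ∀ q ∈ M, ∃ r ∈ M, ‖r - midpoint ℝ p q‖ ≤ c * ‖p - q‖ ^ 2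

/-- The squared distance to `y` grows quadratically on `M` away from a nearest point, as long as
everything happens in a ball whose radius is small compared to `1 / c`. -/
theorem IsAlmostMidpointConvex.quadratic_growth {M : Set E} {z y p q : E} {c ρ : ℝ}
    (hM : IsAlmostMidpointConvex c M) (hc : 0 ≤ c) (hcρ : 64 * (c * ρ) ≤ 1)
    (hMρ : M ⊆ closedBall z ρ) (hy : y ∈ closedBall z ρ) (hp : p ∈ nearestPoints M y)
    (hq : q ∈ M) : ‖y - p‖ ^ 2 + ‖p - q‖ ^ 2 / 4 ≤ ‖y - q‖ ^ 2 := by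
  obtain ⟨r, hr, hrm⟩ := hM p hp.1 q hq
  have hρ : 0 ≤ ρ := dist_nonneg.trans (mem_closedBall.1 hy)
  have hyp := hp.2 r hr
  rw [dist_eq_norm, dist_eq_norm] at hyp
  have hm : midpoint ℝ p q ∈ closedBall z ρ :=
    (convex_closedBall z ρ).segment_subset (hMρ hp.1) (hMρ hq) (midpoint_mem_segment p q)
  have h1 : ‖y - midpoint ℝ p q‖ ≤ 2 * ρ := by
    rw [← dist_eq_norm]
    have := dist_triangle_right y (midpoint ℝ p q) z
    have := mem_closedBall.1 hm
    have := mem_closedBall.1 hy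
    linarith
  have h2 : ‖p - q‖ ≤ 2 * ρ := by
    rw [← dist_eq_norm]
    have := dist_triangle_right p q z
    have := mem_closedBall.1 (hMρ hp.1)
    have := mem_closedBall.1 (hMρ hq)
    linarith
  have h3 : ‖y - r‖ ≤ ‖y - midpoint ℝ p q‖ + c * ‖p - q‖ ^ 2 := by
    have := norm_sub_le (y - midpoint ℝ p q) (r - midpoint ℝ p q)
    rw [sub_sub_sub_cancel_right] at this
    linarith
  have h4 := norm_sub_midpoint_sq y p q
  set d := ‖y - midpoint ℝ p q‖ with hd
  set s := ‖p - q‖ with hs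
  have hs0 : 0 ≤ s := norm_nonneg _
  have hd0 : 0 ≤ d := norm_nonneg _
  have h5 : ‖y - p‖ ^ 2 ≤ (d + c * s ^ 2) ^ 2 :=
    pow_le_pow_left₀ (norm_nonneg _) (hyp.trans h3) 2
  have h6 : d * c ≤ 1 / 32 := by nlinarith
  have h7 : c * s ≤ 1 / 32 := by nlinarith
  have h8 : (c * s) ^ 2 ≤ 1 / 32 := by nlinarith [mul_nonneg hc hs0]
  have h9 : d * c * s ^ 2 ≤ 1 / 32 * s ^ 2 := by gcongr
  have h10 : (c * s) ^ 2 * s ^ 2 ≤ 1 / 32 * s ^ 2 := by gcongr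
  nlinarith

/-- A compact almost midpoint-convex set in a small ball has unique nearest points, and they depend
on the given point in a Lipschitz way. -/
theorem IsAlmostMidpointConvex.exists_projection {M : Set E} {z : E} {c ρ : ℝ}
    (hM : IsAlmostMidpointConvex c M) (hc : 0 ≤ c) (hcρ : 64 * (c * ρ) ≤ 1)
    (hMρ : M ⊆ closedBall z ρ) (hcomp : IsCompact M) (hz : z ∈ M) :
    ∃ S : E → E, IsLipschitzMapFixing (closedBall z ρ) M z S ∧
      ∀ y ∈ closedBall z ρ, nearestPoints M y = {S y} := by
  have hex : ∀ y, ∃ p, p ∈ nearestPoints M y := fun y => by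
    obtain ⟨p, hp, hmin⟩ := hcomp.exists_isMinOn ⟨z, hz⟩
      (f := fun q => dist y q) (continuous_const.dist continuous_id).continuousOn
    exact ⟨p, hp, fun q hq => hmin hq⟩
  have key : ∀ y ∈ closedBall z ρ, ∀ y' ∈ closedBall z ρ, ∀ p ∈ nearestPoints M y,
      ∀ p' ∈ nearestPoints M y', ‖p - p'‖ ≤ 4 * ‖y - y'‖ := by
    intro y hy y' hy' p hp p' hp'
    have h1 := hM.quadratic_growth hc hcρ hMρ hy hp hp'.1
    have h2 := hM.quadratic_growth hc hcρ hMρ hy' hp' hp.1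
    rw [norm_sub_rev p' p] at h2
    have h3 : ‖y - p'‖ ^ 2 - ‖y - p‖ ^ 2 + (‖y' - p‖ ^ 2 - ‖y' - p'‖ ^ 2) =
        2 * inner ℝ (y - y') (p - p') := by
      simp only [norm_sub_sq_real, inner_sub_left, inner_sub_right]
      ring
    have h4 := real_inner_le_norm (y - y') (p - p')
    by_contra! hlt
    have : 0 < ‖p - p'‖ := (by positivity : 0 ≤ 4 * ‖y - y'‖).trans_lt hlt
    nlinarith
  choose S hS using hex
  have hnear : ∀ y ∈ closedBall z ρ, nearestPoints M y = {S y} := fun y hy => by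
    refine Subset.antisymm (fun p hp => ?_) (singleton_subset_iff.2 (hS y))
    have := key y hy y hy p hp (S y) (hS y)
    rw [sub_self, norm_zero, mul_zero] at this
    exact sub_eq_zero.1 (norm_le_zero_iff.1 this)
  refine ⟨S, ⟨fun y _ => (hS y).1, ⟨4, LipschitzOnWith.of_dist_le_mul fun y hy y' hy' => ?_⟩, ?_⟩,
    hnear⟩
  · rw [dist_eq_norm, dist_eq_norm]
    exact key y hy y' hy' _ (hS y) _ (hS y')
  · have := (hS z).2 z hz
    rw [dist_self, dist_le_zero] at this
    exact this.symm

end NearestPoints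

variable {E : Type*} [NormedAddCommGroup E] [InnerProductSpace ℝ E]

/-! ### Balls and restrictions of Lipschitz maps -/

/-- A closed ball that is a neighborhood of its center and lies in an open ball of radius `ρ` can be
given a positive radius less than `ρ`; in the trivial space this needs a change of the radius. -/
theorem exists_closedBall_eq {z : E} {ε ρ : ℝ} (hρ : 0 < ρ) (hmem : closedBall z ε ∈ 𝓝 z)
    (hsub : closedBall z ε ⊆ ball z ρ) :
    ∃ ε', 0 < ε' ∧ ε' < ρ ∧ closedBall z ε = closedBall z ε' := by
  rcases subsingleton_or_nontrivial E with hE | hE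
  · refine ⟨ρ / 2, by positivity, by linarith, ?_⟩
    ext x
    rw [Subsingleton.elim x z]
    exact ⟨fun _ => mem_closedBall_self (by positivity), fun _ => mem_of_mem_nhds hmem⟩
  · refine ⟨ε, ?_, ?_, rfl⟩
    · obtain ⟨η, hη, hηb⟩ := Metric.mem_nhds_iff.1 hmem
      obtain ⟨v, hv⟩ := exists_norm_eq E (half_pos hη).le
      have h1 : z + v ∈ ball z η := by
        rw [mem_ball, dist_self_add_left, hv]; linarith
      have h2 := mem_closedBall.1 (hηb h1)
      rw [dist_self_add_left, hv] at h2
      linarith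
    · by_contra! hle
      obtain ⟨v, hv⟩ := exists_norm_eq E hρ.le
      have h1 : z + v ∈ closedBall z ε := by
        rw [mem_closedBall, dist_self_add_left, hv]; exact hle
      have h2 := mem_ball.1 (hsub h1)
      rw [dist_self_add_left, hv] at h2
      exact lt_irrefl _ h2

theorem IsLipschitzMapFixing.mono {G : Type*} [NormedAddCommGroup G] {A A' B : Set G} {z : G}
    {f : G → G}
    (h : IsLipschitzMapFixing A B z f) (hA : A' ⊆ A) : IsLipschitzMapFixing A' B z f :=
  ⟨h.1.mono_left hA, h.2.1.imp fun _ hK => hK.mono hA, h.2.2⟩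

/-! ### Quadratic convergence -/

/-- A step that is quadratically contracting towards `z`, followed by two Lipschitz maps that
fix `z`, gives a quadratically convergent iteration. -/
theorem exists_quadratic_convergence {X Y M W V : Set E} {z : E} {y S Q : E → E} {C : ℝ}
    (hzY : z ∈ Y) (hzM : z ∈ M) (hW : W ∈ 𝓝 z) (hV : V ∈ 𝓝 z)
    (hy : ∀ᶠ x in 𝓝[X] z, y x ∈ Y ∧ y x - x ∈ tangentSpace X x ∧ dist (y x) z ≤ C * dist x z ^ 2)
    (hS : IsLipschitzMapFixing (Y ∩ V) M z S) (hQ : IsLipschitzMapFixing (M ∩ W) X z Q) :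
    ∃ δ > 0, ∃ C : ℝ, ∀ x : ℕ → E, x 0 ∈ X → dist (x 0) z < δ →
      (∀ k, x (k + 1) = Q (S (y (x k)))) →
      (∀ k, x k ∈ X ∩ W ∧ y (x k) ∈ Y ∩ V ∧ y (x k) - x k ∈ tangentSpace X (x k) ∧
        S (y (x k)) ∈ M ∩ W) ∧
      Tendsto x atTop (𝓝 z) ∧ ∀ k, dist (x (k + 1)) z ≤ C * dist (x k) z ^ 2 := by
  obtain ⟨hSm, ⟨L, hSL⟩, hSz⟩ := hS
  obtain ⟨hQm, ⟨L', hQL⟩, hQz⟩ := hQ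
  have hd : Tendsto (fun x => dist x z) (𝓝[X] z) (𝓝 0) :=
    tendsto_nhdsWithin_of_tendsto_nhds (Continuous.tendsto' (by fun_prop) z 0 (dist_self z))
  have hyt : Tendsto y (𝓝[X] z) (𝓝 z) := by
    refine tendsto_iff_dist_tendsto_zero.2 (squeeze_zero' (.of_forall fun _ => dist_nonneg)
      (hy.mono fun x hx => hx.2.2) ?_)
    simpa using (hd.pow 2).const_mul C
  have hyV : ∀ᶠ x in 𝓝[X] z, y x ∈ Y ∩ V := by
    filter_upwards [hy, hyt.eventually hV] with x h1 h2 using ⟨h1.1, h2⟩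
  have hSd : ∀ᶠ x in 𝓝[X] z, dist (S (y x)) z ≤ L * dist (y x) z := by
    filter_upwards [hyV] with x hx
    have := hSL.dist_le_mul _ hx z ⟨hzY, mem_of_mem_nhds hV⟩
    rwa [hSz] at this
  have hSt : Tendsto (fun x => S (y x)) (𝓝[X] z) (𝓝 z) := by
    refine tendsto_iff_dist_tendsto_zero.2 (squeeze_zero' (.of_forall fun _ => dist_nonneg)
      hSd ?_)
    simpa using (tendsto_iff_dist_tendsto_zero.1 hyt).const_mul (L : ℝ)
  have hSM : ∀ᶠ x in 𝓝[X] z, S (y x) ∈ M ∩ W := by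
    filter_upwards [hyV, hSt.eventually hW] with x h1 h2 using ⟨hSm h1, h2⟩
  set C' : ℝ := L' * (L * C) with hC'
  have hsmall : ∀ᶠ x in 𝓝[X] z, C' * dist x z ≤ 1 / 2 := by
    have h0 : Tendsto (fun x => C' * dist x z) (𝓝[X] z) (𝓝 0) := by
      simpa using hd.const_mul C'
    exact h0.eventually (ge_mem_nhds (by norm_num))
  have hstep : ∀ᶠ x in 𝓝[X] z, (x ∈ X ∩ W ∧ y x ∈ Y ∩ V ∧ y x - x ∈ tangentSpace X x ∧
      S (y x) ∈ M ∩ W) ∧ Q (S (y x)) ∈ X ∧ dist (Q (S (y x))) z ≤ C' * dist x z ^ 2 ∧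
      C' * dist x z ≤ 1 / 2 := by
    filter_upwards [self_mem_nhdsWithin, nhdsWithin_le_nhds hW, hy, hyV, hSd, hSM, hsmall]
      with x h1 h2 h3 h4 h5 h6 h7
    refine ⟨⟨⟨h1, h2⟩, h4, h3.2.1, h6⟩, hQm h6, ?_, h7⟩
    have h8 := hQL.dist_le_mul _ h6 z ⟨hzM, mem_of_mem_nhds hW⟩
    rw [hQz] at h8
    calc _ ≤ _ := h8
      _ ≤ L' * (L * (C * dist x z ^ 2)) := by
        gcongr; exact h5.trans (by gcongr; exact h3.2.2)
      _ = _ := by rw [hC']; ring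
  obtain ⟨δ, hδ, hball⟩ := Metric.mem_nhdsWithin_iff.1 hstep
  refine ⟨δ, hδ, C', fun x hx0 hxδ hrec => ?_⟩
  have hind : ∀ k, x k ∈ X ∧ dist (x k) z ≤ (1 / 2) ^ k * dist (x 0) z := by
    intro k
    induction k with
    | zero => exact ⟨hx0, by simp⟩
    | succ k ih =>
      have hlt : dist (x k) z < δ := by
        refine ih.2.trans_lt (lt_of_le_of_lt ?_ hxδ)
        exact mul_le_of_le_one_left dist_nonneg (pow_le_one₀ (by norm_num) (by norm_num))
      obtain ⟨-, h1, h2, h3⟩ := hball ⟨hlt, ih.1⟩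
      rw [hrec k]
      refine ⟨h1, h2.trans ?_⟩
      rw [sq, ← mul_assoc, pow_succ']
      have h4 := mul_le_mul_of_nonneg_right h3 (dist_nonneg (x := x k) (y := z))
      linarith [ih.2]
  have hgood : ∀ k, x k ∈ ball z δ ∩ X := fun k => by
    refine ⟨(hind k).2.trans_lt (lt_of_le_of_lt ?_ hxδ), (hind k).1⟩
    exact mul_le_of_le_one_left dist_nonneg (pow_le_one₀ (by norm_num) (by norm_num))
  refine ⟨fun k => (hball (hgood k)).1, ?_, fun k => ?_⟩
  · refine tendsto_iff_dist_tendsto_zero.2 (squeeze_zero (fun _ => dist_nonneg)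
      (fun k => (hind k).2) ?_)
    simpa using (tendsto_pow_atTop_nhds_zero_of_lt_one (r := (1 / 2 : ℝ)) (by norm_num)
      (by norm_num)).mul_const (dist (x 0) z)
  · rw [hrec k]
    exact (hball (hgood k)).2.2.1

/-! ### Manifolds near a given point -/

theorem IsLocalEquation.contDiffAt_two {X : Set E} {z : E} {m : ℕ}
    {F : E → EuclideanSpace ℝ (Fin m)} (hF : IsLocalEquation 2 X z F) : ContDiffAt ℝ 2 F z := by
  exact_mod_cast hF.contDiffAt

variable [FiniteDimensional ℝ E]

theorem IsLocalEquation.eventually_one {X : Set E} {z : E} {m : ℕ}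
    {F : E → EuclideanSpace ℝ (Fin m)} (hF : IsLocalEquation 2 X z F) :
    ∀ᶠ x in 𝓝 z, IsLocalEquation 1 X x F := by
  filter_upwards [hF.contDiffAt_two.eventually (by simp),
    eventually_surjective_fderiv (hF.contDiffAt_two.of_le (by norm_num)) hF.surjective,
    hF.eventually_iff.eventually_nhds] with x h1 h2 h3
  exact ⟨by exact_mod_cast h1.of_le (by norm_num), h2, h3⟩

theorem IsLocalEquation.eventually_tangentSpace_eq {X : Set E} {z : E} {m : ℕ}
    {F : E → EuclideanSpace ℝ (Fin m)} (hF : IsLocalEquation 2 X z F) :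
    ∀ᶠ x in 𝓝[X] z, tangentSpace X x = (fderiv ℝ F x).toLinearMap.ker := by
  filter_upwards [nhdsWithin_le_nhds hF.eventually_one, self_mem_nhdsWithin] with x hx hxX
  exact tangentSpace_eq hxX hx

/-- A manifold is locally closed, so its intersections with small closed balls are compact. -/
theorem IsManifoldAround.exists_isCompact {r : ℕ} {X : Set E} {z : E}
    (hX : IsManifoldAround r X z) (hr : r ≠ 0) :
    ∃ ρ > 0, ∀ y ε, closedBall y ε ⊆ ball z ρ → IsCompact (X ∩ closedBall y ε) := by
  obtain ⟨-, m, F, hF⟩ := hX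
  have hc : ∀ᶠ x in 𝓝 z, ContinuousAt F x := by
    have h1 : ContDiffAt ℝ 1 F z := hF.contDiffAt.of_le (by
      exact_mod_cast Nat.one_le_iff_ne_zero.2 hr)
    filter_upwards [h1.eventually (by simp)] with x hx
    exact hx.continuousAt
  obtain ⟨ρ, hρ, hball⟩ := Metric.eventually_nhds_iff_ball.1 (hc.and hF.eventually_iff)
  refine ⟨ρ, hρ, fun y ε hε => ?_⟩
  have : X ∩ closedBall y ε = closedBall y ε ∩ F ⁻¹' {0} := by
    ext x
    constructor
    · rintro ⟨h1, h2⟩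
      exact ⟨h2, (hball x (hε h2)).2.1 h1⟩
    · rintro ⟨h2, h1⟩
      exact ⟨(hball x (hε h2)).2.2 h1, h2⟩
  rw [this]
  refine (isCompact_closedBall y ε).of_isClosed_subset ?_ inter_subset_left
  exact ContinuousOn.preimage_isClosed_of_isClosed
    (fun x hx => (hball x (hε hx)).1.continuousWithinAt) isClosed_closedBall isClosed_singleton

/-! ### The constant rank theorem -/

/-- The coordinates of a point `x` with respect to the base point `z`: the `R`-part of `P x - z` and
the `K`-part of `x - z`. -/
noncomputable def adaptedCoord (P : E → E) (z : E) (R K : Submodule ℝ E) (x : E) : R × K :=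
  (R.orthogonalProjectionOnto (P x - z), K.orthogonalProjectionOnto (x - z))

/-- A parametrization `φ` of `X` around `z` in which `P` becomes the projection to the first
variable, followed by an immersion `ψ`: the parameter of a point `x` of `X` near `z` is
`adaptedCoord P z R K x`, and `P (φ (a, b)) = ψ a`. The image `ψ` is a graph over `z + R`. -/
structure IsAdaptedChart (X : Set E) (P : E → E) (z : E) (R K : Submodule ℝ E)
    (φ : R × K → E) (ψ : R → E) : Prop where
  contDiffAt_chart : ContDiffAt ℝ 2 φ 0
  contDiffAt_image : ContDiffAt ℝ 2 ψ 0
  chart_zero : φ 0 = z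
  chart_mem : ∀ᶠ c in 𝓝 0, φ c ∈ X
  map_chart : ∀ᶠ c in 𝓝 0, P (φ c) = ψ c.1
  proj_image : ∀ᶠ a in 𝓝 0, R.orthogonalProjectionOnto (ψ a - z) = a
  proj_chart : ∀ᶠ c in 𝓝 0, K.orthogonalProjectionOnto (φ c - z) = c.2
  chart_coord : ∀ᶠ x in 𝓝[X] z, φ (adaptedCoord P z R K x) = x
  exists_lipschitz : ∃ L : ℝ≥0, ∃ t ∈ 𝓝[X] z, LipschitzOnWith L P t

/-- If a linear map whose rank is at most `dim R` has surjective `R`-part, it vanishes wherever its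
`R`-part does. -/
theorem eq_zero_of_proj_eq_zero {A : Type*} [AddCommGroup A] [Module ℝ A] {R : Submodule ℝ E}
    (g : A →ₗ[ℝ] E) (hrank : Module.finrank ℝ g.range ≤ Module.finrank ℝ R)
    (hsurj : ∀ r : R, ∃ v, R.orthogonalProjectionOnto (g v) = r) {v : A}
    (hv : R.orthogonalProjectionOnto (g v) = 0) : g v = 0 := by
  set p : g.range →ₗ[ℝ] R :=
    (R.orthogonalProjectionOnto : E →ₗ[ℝ] R).domRestrict g.range with hp
  have hs : Function.Surjective p := fun r => by
    obtain ⟨v, hv⟩ := hsurj r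
    exact ⟨⟨g v, v, rfl⟩, hv⟩
  have hle : Module.finrank ℝ R ≤ Module.finrank ℝ g.range :=
    LinearMap.finrank_le_finrank_of_surjective hs
  have hi : Function.Injective p :=
    (LinearMap.injective_iff_surjective_of_finrank_eq_finrank (le_antisymm hrank hle)).2 hs
  have h0 : (⟨g v, v, rfl⟩ : g.range) = 0 := hi (by rw [map_zero]; exact hv)
  exact congrArg Subtype.val h0

/-- The constant rank theorem, for the restriction of a map to a manifold. -/
theorem exists_isAdaptedChart {X : Set E} {z : E} (hX : IsManifoldAround 2 X z) {P : E → E}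
    (hPz : P z = z) (hP : IsSmoothOfConstantRankNear 2 X P z) :
    ∃ (R K : Submodule ℝ E) (φ : R × K → E) (ψ : R → E), IsAdaptedChart X P z R K φ ψ := by
  obtain ⟨hzX, m, F, hF⟩ := hX
  obtain ⟨P', hP', hPP', k, hk⟩ := hP
  replace hP' : ContDiffAt ℝ 2 P' z := by exact_mod_cast hP'
  have hFc := hF.contDiffAt_two
  have hP'z : P' z = z := (hPP'.self_of_nhdsWithin hzX).symm.trans hPz
  have hFz : F z = 0 := hF.eventually_iff.self_of_nhds.1 hzX
  have htan := hF.eventually_tangentSpace_eq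
  set D := fderiv ℝ P' z with hD
  set T : Submodule ℝ E := (fderiv ℝ F z).toLinearMap.ker with hT
  set R : Submodule ℝ E := T.map D.toLinearMap with hR
  set K : Submodule ℝ E := T ⊓ D.toLinearMap.ker with hK
  have hRk : Module.finrank ℝ R = k := by
    have := hk.self_of_nhdsWithin hzX
    rwa [htan.self_of_nhdsWithin hzX] at this
  -- `Φ` straightens `X` and `P` simultaneously
  set Φ : E → EuclideanSpace ℝ (Fin m) × (R × K) := fun x =>
    (F x, R.orthogonalProjectionOnto (P' x - z), K.orthogonalProjectionOnto (x - z)) with hΦ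
  have hΦc : ContDiffAt ℝ 2 Φ z :=
    hFc.prodMk (((R.orthogonalProjectionOnto).contDiff.contDiffAt.comp z
      (hP'.sub contDiffAt_const)).prodMk ((K.orthogonalProjectionOnto).contDiff.contDiffAt.comp z
      (contDiffAt_id.sub contDiffAt_const)))
  set Φ' : E →L[ℝ] EuclideanSpace ℝ (Fin m) × (R × K) :=
    (fderiv ℝ F z).prod ((R.orthogonalProjectionOnto ∘L D).prod K.orthogonalProjectionOnto) with hΦ'
  have hΦd : HasFDerivAt Φ Φ' z := by
    refine (hFc.differentiableAt (by norm_num)).hasFDerivAt.prodMk (HasFDerivAt.prodMk ?_ ?_)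
    · exact (R.orthogonalProjectionOnto).hasFDerivAt.comp z
        ((hP'.differentiableAt (by norm_num)).hasFDerivAt.sub_const z)
    · exact (K.orthogonalProjectionOnto).hasFDerivAt.comp z ((hasFDerivAt_id z).sub_const z)
  have hinj : Φ'.ker = ⊥ := by
    refine (Submodule.eq_bot_iff _).2 fun v hv => ?_
    have hv' : Φ' v = 0 := hv
    simp only [hΦ', ContinuousLinearMap.prod_apply, Prod.mk_eq_zero,
      ContinuousLinearMap.comp_apply] at hv'
    obtain ⟨h1, h2, h3⟩ := hv'
    have hvT : v ∈ T := h1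
    have hDv : D v ∈ R := Submodule.mem_map_of_mem hvT
    have hD0 : D v = 0 := by
      have := R.orthogonalProjectionOnto_mem_subspace_eq_self ⟨D v, hDv⟩
      rw [h2] at this
      exact (congrArg Subtype.val this).symm
    have := K.orthogonalProjectionOnto_mem_subspace_eq_self ⟨v, hvT, hD0⟩
    rw [h3] at this
    exact (congrArg Subtype.val this).symm
  have hsur : Φ'.range = ⊤ := by
    refine LinearMap.range_eq_top.2 ?_
    rintro ⟨u, r, κ⟩
    -- correct the three components one after the other, the last two inside `T` and `K`
    obtain ⟨v, hv⟩ := hF.surjective u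
    obtain ⟨t, htT, ht⟩ := (r - R.orthogonalProjectionOnto (D v)).2
    set q : K := κ - K.orthogonalProjectionOnto (v + t) with hq
    refine ⟨v + t + q, ?_⟩
    have ht0 : fderiv ℝ F z t = 0 := htT
    have hq0 : fderiv ℝ F z q = 0 := q.2.1
    have hq1 : D q = 0 := q.2.2
    have ht1 : D t = ((r - R.orthogonalProjectionOnto (D v) : R) : E) := ht
    change Φ' (v + t + q) = _
    simp only [hΦ', ContinuousLinearMap.prod_apply, ContinuousLinearMap.comp_apply, map_add, ht0,
      hq0, hq1, hv, ht1, Submodule.orthogonalProjectionOnto_mem_subspace_eq_self]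
    refine Prod.ext (by simp) (Prod.ext ?_ ?_)
    · simp
    · simp [hq]
  set e := ContinuousLinearEquiv.ofBijective Φ' hinj hsur with he
  have hΦe : HasFDerivAt Φ (e : E →L[ℝ] _) z := by
    rw [he, ContinuousLinearEquiv.coe_ofBijective]; exact hΦd
  have hst := hΦc.hasStrictFDerivAt' hΦe (by norm_num)
  set g := hΦc.localInverse hΦe (by norm_num) with hg
  have hΦz : Φ z = 0 := by
    simp only [hΦ, hFz, hP'z, sub_self, map_zero]; rfl
  have hgc : ContDiffAt ℝ 2 g 0 := hΦz ▸ hΦc.to_localInverse hΦe (by norm_num)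
  have hgz : g 0 = z := by
    have := hΦc.localInverse_apply_image hΦe (by norm_num)
    rwa [hΦz] at this
  have hright : ∀ᶠ y in 𝓝 0, Φ (g y) = y := hΦz ▸ hst.eventually_right_inverse
  have hleft : ∀ᶠ x in 𝓝 z, g (Φ x) = x := hst.eventually_left_inverse
  set φ : R × K → E := fun c => g (0, c) with hφ
  have hin : ContDiff ℝ 2 (fun c : R × K => ((0 : EuclideanSpace ℝ (Fin m)), c)) :=
    contDiff_const.prodMk contDiff_id
  have hφc : ContDiffAt ℝ 2 φ 0 := ContDiffAt.comp (0 : R × K) (g := g) hgc hin.contDiffAt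
  have hφz : φ 0 = z := hgz
  have hφt : Tendsto φ (𝓝 0) (𝓝 z) := by
    have := hφc.continuousAt.tendsto
    rwa [hφz] at this
  have hφr : ∀ᶠ c in 𝓝 0, Φ (φ c) = (0, c) :=
    (hin.continuous.tendsto' (0 : R × K) 0 rfl).eventually hright
  have hFφ : ∀ᶠ c in 𝓝 0, F (φ c) = 0 := hφr.mono fun c hc => congrArg Prod.fst hc
  have hmem : ∀ᶠ c in 𝓝 0, φ c ∈ X := by
    filter_upwards [hFφ, hφt.eventually hF.eventually_iff] with c h1 h2 using h2.2 h1
  have hφX : Tendsto φ (𝓝 0) (𝓝[X] z) := tendsto_nhdsWithin_iff.2 ⟨hφt, hmem⟩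
  set h : R × K → E := fun c => P' (φ c) with hh
  have hhc : ContDiffAt ℝ 2 h 0 := by
    refine ContDiffAt.comp (0 : R × K) (g := P') ?_ hφc
    rw [hφz]; exact hP'
  have hproj : ∀ᶠ c in 𝓝 0, R.orthogonalProjectionOnto (h c - z) = c.1 :=
    hφr.mono fun c hc => congrArg (fun u => u.2.1) hc
  -- by the constancy of the rank, `h` does not depend on the second variable
  have hder : ∀ᶠ c : R × K in 𝓝 0, DifferentiableAt ℝ h c ∧ ∀ b : K, fderiv ℝ h c (0, b) = 0 := by
    filter_upwards [hφc.eventually (by simp), hhc.eventually (by simp),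
      hφt.eventually (hP'.eventually (by simp)), hφt.eventually (hFc.eventually (by simp)),
      hFφ.eventually_nhds, hproj.eventually_nhds, hφX.eventually hk, hφX.eventually htan]
      with c h1 h2 h3 h4 h5 h6 h7 h8
    have d1 := (h1.differentiableAt (by norm_num)).hasFDerivAt
    have d2 := (h2.differentiableAt (by norm_num)).hasFDerivAt
    have d3 := (h3.differentiableAt (by norm_num)).hasFDerivAt
    have d4 := (h4.differentiableAt (by norm_num)).hasFDerivAt
    refine ⟨d2.differentiableAt, fun b => ?_⟩
    have e1 : fderiv ℝ h c = (fderiv ℝ P' (φ c)).comp (fderiv ℝ φ c) := (d3.comp c d1).fderiv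
    have e2 : (fderiv ℝ F (φ c)).comp (fderiv ℝ φ c) = 0 :=
      (d4.comp c d1).unique ((hasFDerivAt_const (0 : EuclideanSpace ℝ (Fin m)) c
        ).congr_of_eventuallyEq h5)
    have e3 : (R.orthogonalProjectionOnto).comp (fderiv ℝ h c) = ContinuousLinearMap.fst ℝ R K :=
      ((R.orthogonalProjectionOnto).hasFDerivAt.comp c (d2.sub_const z)).unique
        (hasFDerivAt_fst.congr_of_eventuallyEq h6)
    have e3' : ∀ v : R × K, R.orthogonalProjectionOnto (fderiv ℝ h c v) = v.1 := fun v =>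
      congrArg (fun L => L v) e3
    refine eq_zero_of_proj_eq_zero (fderiv ℝ h c).toLinearMap ?_ (fun r => ⟨(r, 0), e3' (r, 0)⟩)
      (e3' (0, b))
    rw [hRk, ← h7, h8]
    refine Submodule.finrank_mono ?_
    rintro _ ⟨v, rfl⟩
    refine ⟨fderiv ℝ φ c v, LinearMap.mem_ker.2 (congrArg
      (fun L : R × K →L[ℝ] EuclideanSpace ℝ (Fin m) => L v) e2), ?_⟩
    exact (congrArg (fun L => L v) e1).symm
  obtain ⟨r, hr, hball⟩ := Metric.eventually_nhds_iff_ball.1 hder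
  have hconst : ∀ᶠ c in 𝓝 0, h c = h (c.1, 0) := by
    filter_upwards [ball_mem_nhds 0 hr] with c hc
    have hmem' : ∀ b ∈ ball (0 : K) r, (c.1, b) ∈ ball (0 : R × K) r := fun b hb => by
      rw [mem_ball, Prod.dist_eq] at hc ⊢
      exact max_lt ((le_max_left _ _).trans_lt hc) hb
    have hd : ∀ b ∈ ball (0 : K) r,
        HasFDerivWithinAt (fun b => h (c.1, b)) (0 : K →L[ℝ] E) (ball 0 r) b := fun b hb => by
      have h1 := hball _ (hmem' b hb)
      have h2 := h1.1.hasFDerivAt.comp b (hasFDerivAt_prodMk_right c.1 b)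
      have h3 : (fderiv ℝ h (c.1, b)).comp (ContinuousLinearMap.inr ℝ R K) = 0 :=
        ContinuousLinearMap.ext fun v => h1.2 v
      rw [h3] at h2
      exact h2.hasFDerivWithinAt
    have hc2 : c.2 ∈ ball (0 : K) r := by
      rw [mem_ball, Prod.dist_eq] at hc
      exact (le_max_right _ _).trans_lt hc
    have := (convex_ball (0 : K) r).norm_image_sub_le_of_norm_hasFDerivWithin_le
      (C := 0) hd (fun _ _ => by simp) (mem_ball_self hr) hc2
    rw [zero_mul, norm_le_zero_iff, sub_eq_zero] at this
    exact this
  have hin' : ContDiff ℝ 2 (fun a : R => (a, (0 : K))) := contDiff_id.prodMk contDiff_const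
  have hin0 : Tendsto (fun a : R => (a, (0 : K))) (𝓝 0) (𝓝 0) := hin'.continuous.tendsto' 0 0 rfl
  refine ⟨R, K, φ, fun a => h (a, 0), hφc,
    ContDiffAt.comp (0 : R) (g := h) hhc hin'.contDiffAt, hφz, hmem, ?_, hin0.eventually hproj,
    hφr.mono fun c hc => congrArg (fun u => u.2.2) hc, ?_, ?_⟩
  · filter_upwards [hconst, hφX.eventually hPP'] with c h1 h2
    rw [h2]; exact h1
  · filter_upwards [nhdsWithin_le_nhds hleft, hPP', nhdsWithin_le_nhds hF.eventually_iff,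
      self_mem_nhdsWithin] with x h1 h2 h3 h4
    have hx : ((0 : EuclideanSpace ℝ (Fin m)), adaptedCoord P z R K x) = Φ x :=
      Prod.ext (h3.1 h4).symm (by simp only [hΦ, adaptedCoord, h2])
    change g (0, adaptedCoord P z R K x) = x
    rw [hx, h1]
  · obtain ⟨L, t, ht, hL⟩ := (hP'.of_le (m := 1) (by norm_num)).exists_lipschitzOnWith
    refine ⟨L, _, inter_mem (nhdsWithin_le_nhds ht) hPP', fun x hx y hy => ?_⟩
    have hx' : P x = P' x := hx.2
    have hy' : P y = P' y := hy.2
    rw [hx', hy']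
    exact hL hx.1 hy.1

theorem norm_orthogonalProjectionOnto_apply_le (R : Submodule ℝ E) (v : E) :
    ‖R.orthogonalProjectionOnto v‖ ≤ ‖v‖ := by
  simpa using (R.orthogonalProjectionOnto.le_opNorm v).trans
    (mul_le_of_le_one_left (norm_nonneg v) R.orthogonalProjectionOnto_norm_le)

/-- The properties of an adapted chart, with explicit radii `r` in the parameter space and `ρ`
in the ambient space, and one constant `C` for all estimates. -/
structure IsUniformChart (X : Set E) (P : E → E) (z : E) (R K : Submodule ℝ E)
    (φ : R × K → E) (ψ : R → E) (C r ρ : ℝ) : Prop extends IsAdaptedChart X P z R K φ ψ where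
  one_le : 1 ≤ C
  r_pos : 0 < r
  ρ_pos : 0 < ρ
  control_chart : QuadraticControl φ (ball 0 r) C
  control_image : QuadraticControl ψ (ball 0 r) C
  mem_of_ball : ∀ c ∈ ball (0 : R × K) r, φ c ∈ X
  map_of_ball : ∀ c ∈ ball (0 : R × K) r, P (φ c) = ψ c.1
  proj_chart_of_ball : ∀ c ∈ ball (0 : R × K) r, K.orthogonalProjectionOnto (φ c - z) = c.2
  coord_mem : ∀ x ∈ X ∩ ball z ρ, adaptedCoord P z R K x ∈ ball (0 : R × K) r
  chart_coord_of_ball : ∀ x ∈ X ∩ ball z ρ, φ (adaptedCoord P z R K x) = x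
  coord_lipschitz : ∀ x ∈ X ∩ ball z ρ, ∀ y ∈ X ∩ ball z ρ,
    ‖adaptedCoord P z R K x - adaptedCoord P z R K y‖ ≤ C * ‖x - y‖
  map_lipschitz : ∀ x ∈ X ∩ ball z ρ, ∀ y ∈ X ∩ ball z ρ, ‖P x - P y‖ ≤ C * ‖x - y‖

theorem IsAdaptedChart.exists_isUniformChart {X : Set E} {P : E → E} {z : E}
    {R K : Submodule ℝ E} {φ : R × K → E} {ψ : R → E} (h : IsAdaptedChart X P z R K φ ψ)
    (hzX : z ∈ X) (hPz : P z = z) : ∃ C r ρ, IsUniformChart X P z R K φ ψ C r ρ := by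
  obtain ⟨C₁, hC₁, r₁, hr₁, h₁⟩ := exists_quadraticControl h.contDiffAt_chart
  obtain ⟨C₂, hC₂, r₂, hr₂, h₂⟩ := exists_quadraticControl h.contDiffAt_image
  obtain ⟨L, t, ht, hL⟩ := h.exists_lipschitz
  obtain ⟨r₃, hr₃, h₃⟩ := Metric.eventually_nhds_iff_ball.1
    ((h.chart_mem.and h.map_chart).and h.proj_chart)
  set C := C₁ + C₂ + L + 1 with hC
  have hL0 := L.coe_nonneg
  set r := min (min r₁ r₂) r₃ with hr
  have hr0 : 0 < r := lt_min (lt_min hr₁ hr₂) hr₃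
  have hrr₁ : r ≤ r₁ := (min_le_left _ _).trans (min_le_left _ _)
  have hrr₂ : r ≤ r₂ := (min_le_left _ _).trans (min_le_right _ _)
  have hrr₃ : r ≤ r₃ := min_le_right _ _
  obtain ⟨ρ₁, hρ₁, hb⟩ := Metric.mem_nhdsWithin_iff.1 (inter_mem ht h.chart_coord)
  have hPL : ∀ x ∈ X ∩ ball z ρ₁, ∀ y ∈ X ∩ ball z ρ₁, ‖P x - P y‖ ≤ L * ‖x - y‖ := by
    intro x hx y hy
    have := hL.dist_le_mul x (hb hx.symm).1 y (hb hy.symm).1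
    rwa [dist_eq_norm, dist_eq_norm] at this
  have hcL : ∀ x ∈ X ∩ ball z ρ₁, ∀ y ∈ X ∩ ball z ρ₁,
      ‖adaptedCoord P z R K x - adaptedCoord P z R K y‖ ≤ (L + 1) * ‖x - y‖ := by
    intro x hx y hy
    have e1 : (adaptedCoord P z R K x - adaptedCoord P z R K y).1 =
        R.orthogonalProjectionOnto (P x - P y) := by simp [adaptedCoord]
    have e2 : (adaptedCoord P z R K x - adaptedCoord P z R K y).2 =
        K.orthogonalProjectionOnto (x - y) := by simp [adaptedCoord]
    rw [Prod.norm_def, e1, e2]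
    have hn := norm_nonneg (x - y)
    refine max_le ?_ ?_
    · have := (norm_orthogonalProjectionOnto_apply_le R (P x - P y)).trans (hPL x hx y hy)
      nlinarith
    · have := norm_orthogonalProjectionOnto_apply_le K (x - y)
      nlinarith
  have hzc : adaptedCoord P z R K z = 0 := by
    simp only [adaptedCoord, hPz, sub_self, map_zero]; rfl
  set ρ := min ρ₁ (r / (L + 1)) with hρ
  have hρ0 : 0 < ρ := lt_min hρ₁ (by positivity)
  have hsub : X ∩ ball z ρ ⊆ X ∩ ball z ρ₁ :=
    inter_subset_inter_right _ (ball_subset_ball (min_le_left _ _))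
  have quad : ∀ {A : Type _} [NormedAddCommGroup A] [NormedSpace ℝ A] {f : A → E} {s C' : ℝ},
      QuadraticControl f (ball 0 s) C' → r ≤ s → C' ≤ C → QuadraticControl f (ball 0 r) C := by
    intro A _ _ f s C' hf hrs hCC
    have hf' := hf.mono (ball_subset_ball (x := (0 : A)) hrs)
    exact ⟨hf'.differentiableAt,
      fun x hx y hy => (hf'.fderiv_sub_le x hx y hy).trans (by gcongr),
      fun x hx y hy => (hf'.taylor x hx y hy).trans (by gcongr),
      fun x hx y hy => (hf'.lipschitz x hx y hy).trans (by gcongr),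
      fun x hx y hy => (hf'.midpoint x hx y hy).trans (by gcongr)⟩
  refine ⟨C, r, ρ, { h with
    one_le := by linarith
    r_pos := hr0
    ρ_pos := hρ0
    control_chart := quad h₁ hrr₁ (by linarith)
    control_image := quad h₂ hrr₂ (by linarith)
    mem_of_ball := fun c hc => (h₃ c (ball_subset_ball hrr₃ hc)).1.1
    map_of_ball := fun c hc => (h₃ c (ball_subset_ball hrr₃ hc)).1.2
    proj_chart_of_ball := fun c hc => (h₃ c (ball_subset_ball hrr₃ hc)).2
    coord_mem := fun x hx => ?_
    chart_coord_of_ball := fun x hx => (hb (hsub hx).symm).2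
    coord_lipschitz := fun x hx y hy => (hcL x (hsub hx) y (hsub hy)).trans
      (by gcongr; linarith)
    map_lipschitz := fun x hx y hy => (hPL x (hsub hx) y (hsub hy)).trans
      (by gcongr; linarith) }⟩
  have h1 := hcL x (hsub hx) z ⟨hzX, mem_ball_self hρ₁⟩
  rw [hzc, sub_zero] at h1
  rw [mem_ball_zero_iff]
  have h2 : ‖x - z‖ < r / (L + 1) := by
    rw [← dist_eq_norm]; exact (mem_ball.1 hx.2).trans_le (min_le_right _ _)
  rw [lt_div_iff₀ (by positivity)] at h2
  linarith

namespace IsUniformChart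

variable {X : Set E} {P : E → E} {z : E} {R K : Submodule ℝ E} {φ : R × K → E} {ψ : R → E}
  {C r ρ : ℝ}

theorem map_eq (h : IsUniformChart X P z R K φ ψ C r ρ) {x : E} (hx : x ∈ X ∩ ball z ρ) :
    P x = ψ (R.orthogonalProjectionOnto (P x - z)) := by
  have := h.map_of_ball _ (h.coord_mem x hx)
  rwa [h.chart_coord_of_ball x hx] at this

/-! ### The image of the manifold -/

/-- Near `z`, the image `P (X ∩ W)` is the graph of `ψ`, whatever the small neighborhood `W`. -/
theorem eventually_mem_image_iff (h : IsUniformChart X P z R K φ ψ C r ρ) {W : Set E}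
    (hW : W ∈ 𝓝 z) (hWρ : W ⊆ ball z ρ) :
    ∀ᶠ w in 𝓝 z, w ∈ P '' (X ∩ W) ↔ w = ψ (R.orthogonalProjectionOnto (w - z)) := by
  have hc : Tendsto (fun w => (R.orthogonalProjectionOnto (w - z), (0 : K))) (𝓝 z) (𝓝 0) := by
    refine Continuous.tendsto' (by fun_prop) _ _ ?_
    rw [sub_self, map_zero]; rfl
  have hφ : Tendsto φ (𝓝 0) (𝓝 z) := by
    have := h.contDiffAt_chart.continuousAt.tendsto
    rwa [h.chart_zero] at this
  filter_upwards [hc.eventually (ball_mem_nhds 0 h.r_pos), hc.eventually (hφ.eventually hW)]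
    with w h1 h2
  constructor
  · rintro ⟨x, hx, rfl⟩
    exact h.map_eq ⟨hx.1, hWρ hx.2⟩
  · intro hw
    exact ⟨_, ⟨h.mem_of_ball _ h1, h2⟩, (h.map_of_ball _ h1).trans hw.symm⟩

theorem isManifoldAround_image (h : IsUniformChart X P z R K φ ψ C r ρ) (hzX : z ∈ X)
    (hPz : P z = z) {W : Set E} (hW : W ∈ 𝓝 z) (hWρ : W ⊆ ball z ρ) :
    IsManifoldAround 2 (P '' (X ∩ W)) z := by
  refine ⟨⟨z, ⟨hzX, mem_of_mem_nhds hW⟩, hPz⟩, Module.finrank ℝ Rᗮ, ?_⟩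
  -- the equation of the graph of `ψ`, read in an orthonormal basis of `Rᗮ`
  set b := (stdOrthonormalBasis ℝ Rᗮ).repr with hb
  set A : E →L[ℝ] EuclideanSpace ℝ (Fin (Module.finrank ℝ Rᗮ)) :=
    (b.toContinuousLinearEquiv : Rᗮ →L[ℝ] _) ∘L Rᗮ.orthogonalProjectionOnto with hA
  set θ : E → E := fun w => w - ψ (R.orthogonalProjectionOnto (w - z)) with hθ
  have hA0 : ∀ v, A v = 0 ↔ v ∈ R := fun v => by
    rw [hA]
    simp only [ContinuousLinearMap.comp_apply, ContinuousLinearEquiv.coe_coe]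
    rw [b.toContinuousLinearEquiv.map_eq_zero_iff,
      Submodule.orthogonalProjectionOnto_eq_zero_iff, Submodule.orthogonal_orthogonal]
  have hπ : ContDiff ℝ 2 (fun w => R.orthogonalProjectionOnto (w - z)) := by fun_prop
  have hπz : R.orthogonalProjectionOnto (z - z) = 0 := by rw [sub_self, map_zero]
  have hψ : ContDiffAt ℝ 2 (fun w => ψ (R.orthogonalProjectionOnto (w - z))) z := by
    refine ContDiffAt.comp z (g := ψ) ?_ hπ.contDiffAt
    rw [hπz]; exact h.contDiffAt_image
  have hθd : HasFDerivAt θ (ContinuousLinearMap.id ℝ E -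
      (fderiv ℝ ψ 0) ∘L R.orthogonalProjectionOnto) z := by
    refine (hasFDerivAt_id z).sub (HasFDerivAt.comp z (g := ψ) ?_
      (R.orthogonalProjectionOnto.hasFDerivAt.comp z ((hasFDerivAt_id z).sub_const z)))
    rw [hπz]
    exact (h.contDiffAt_image.differentiableAt (by norm_num)).hasFDerivAt
  refine ⟨fun w => A (θ w), ?_, ?_, ?_⟩
  · exact_mod_cast A.contDiff.contDiffAt.comp z (contDiffAt_id.sub hψ)
  · have hd : fderiv ℝ (fun w => A (θ w)) z = A ∘L (ContinuousLinearMap.id ℝ E -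
      (fderiv ℝ ψ 0) ∘L R.orthogonalProjectionOnto) := (A.hasFDerivAt.comp z hθd).fderiv
    intro u
    refine ⟨(b.symm u : Rᗮ), ?_⟩
    rw [hd]
    have h0 : R.orthogonalProjectionOnto ((b.symm u : Rᗮ) : E) = 0 :=
      Submodule.orthogonalProjectionOnto_eq_zero_iff.2 (b.symm u).2
    simp only [ContinuousLinearMap.comp_apply, sub_apply, h0, map_zero,
      sub_zero, hA, ContinuousLinearMap.id_apply,
      Submodule.orthogonalProjectionOnto_mem_subspace_eq_self]
    exact b.apply_symm_apply u
  · have ht : Tendsto (fun w => R.orthogonalProjectionOnto (w - z)) (𝓝 z) (𝓝 0) :=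
      hπ.continuous.tendsto' _ _ hπz
    filter_upwards [h.eventually_mem_image_iff hW hWρ, ht.eventually h.proj_image] with w h1 h2
    rw [h1, hA0]
    constructor
    · intro hw
      have : θ w = 0 := sub_eq_zero.2 hw
      rw [this]; exact R.zero_mem
    · intro hw
      have h3 := R.orthogonalProjectionOnto_mem_subspace_eq_self ⟨θ w, hw⟩
      have h4 : θ w = (w - z) - (ψ (R.orthogonalProjectionOnto (w - z)) - z) := by
        simp only [hθ]; abel
      have h5 : R.orthogonalProjectionOnto (θ w) = 0 := by
        rw [h4, map_sub, h2, sub_self]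
      have h6 : θ w = 0 := (congrArg Subtype.val (h3.symm.trans h5))
      exact sub_eq_zero.1 h6

/-! ### The projection onto the image -/

/-- Balls are uniformly convex: their midpoints are so far inside that the chart midpoint of two
points of `X` in a small ball stays in that ball. So the image is almost midpoint-convex, with a
constant that does not depend on the radius. -/
theorem isAlmostMidpointConvex_image (h : IsUniformChart X P z R K φ ψ C r ρ) {ε : ℝ}
    (hε : 0 < ε) (hερ : ε < ρ) (hεC : 8 * (ε * C ^ 3) ≤ 1) :
    IsAlmostMidpointConvex C (P '' (X ∩ closedBall z ε)) := by
  rintro _ ⟨x₁, ⟨h1X, h1⟩, rfl⟩ _ ⟨x₂, ⟨h2X, h2⟩, rfl⟩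
  have hC0 : 0 < C := zero_lt_one.trans_le h.one_le
  have h1ρ : x₁ ∈ X ∩ ball z ρ := ⟨h1X, closedBall_subset_ball hερ h1⟩
  have h2ρ : x₂ ∈ X ∩ ball z ρ := ⟨h2X, closedBall_subset_ball hερ h2⟩
  have hc1 := h.coord_mem _ h1ρ
  have hc2 := h.coord_mem _ h2ρ
  have e1 := h.chart_coord_of_ball _ h1ρ
  have e2 := h.chart_coord_of_ball _ h2ρ
  have hlip := h.coord_lipschitz _ h1ρ _ h2ρ
  set c₁ := adaptedCoord P z R K x₁ with hc₁
  set c₂ := adaptedCoord P z R K x₂ with hc₂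
  have hm : midpoint ℝ c₁ c₂ ∈ ball (0 : R × K) r :=
    (convex_ball 0 r).segment_subset hc1 hc2 (midpoint_mem_segment c₁ c₂)
  refine ⟨P (φ (midpoint ℝ c₁ c₂)), ⟨_, ⟨h.mem_of_ball _ hm, ?_⟩, rfl⟩, ?_⟩
  · have hmid := h.control_chart.midpoint c₁ hc1 c₂ hc2
    rw [e1, e2] at hmid
    have hp := norm_sub_midpoint_sq z x₁ x₂
    rw [mem_closedBall, dist_eq_norm, norm_sub_rev] at h1 h2
    rw [mem_closedBall, dist_eq_norm]
    have htri : ‖φ (midpoint ℝ c₁ c₂) - z‖ ≤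
        ‖φ (midpoint ℝ c₁ c₂) - midpoint ℝ x₁ x₂‖ + ‖z - midpoint ℝ x₁ x₂‖ := by
      rw [norm_sub_rev z]
      exact norm_sub_le_norm_sub_add_norm_sub _ _ _
    set s := ‖x₁ - x₂‖ with hs
    set t := ‖z - midpoint ℝ x₁ x₂‖ with ht
    have ht0 : 0 ≤ t := norm_nonneg _
    have hb1 : ‖z - x₁‖ ^ 2 ≤ ε ^ 2 := pow_le_pow_left₀ (norm_nonneg _) h1 2
    have hb2 : ‖z - x₂‖ ^ 2 ≤ ε ^ 2 := pow_le_pow_left₀ (norm_nonneg _) h2 2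
    have hcs : C * ‖c₁ - c₂‖ ^ 2 ≤ C ^ 3 * s ^ 2 := by
      have : ‖c₁ - c₂‖ ^ 2 ≤ (C * s) ^ 2 := pow_le_pow_left₀ (norm_nonneg _) hlip 2
      nlinarith
    have hts : t ^ 2 ≤ ε ^ 2 - s ^ 2 / 4 := by linarith
    have htε : t ≤ ε := by
      refine le_of_sq_le_sq ?_ hε.le
      nlinarith [sq_nonneg s]
    have hgoal : t + C ^ 3 * s ^ 2 ≤ ε := by
      by_contra! hlt
      have a1 : 2 * ε * (ε - t) < 2 * ε * (C ^ 3 * s ^ 2) := by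
        apply mul_lt_mul_of_pos_left _ (by positivity); linarith
      have a2 : (ε - t) * (ε + t) ≤ (ε - t) * (2 * ε) :=
        mul_le_mul_of_nonneg_left (by linarith) (by linarith)
      nlinarith [mul_le_mul_of_nonneg_right hεC (sq_nonneg s)]
    linarith
  · have hfst : (midpoint ℝ c₁ c₂).1 = midpoint ℝ c₁.1 c₂.1 := by
      simp [midpoint_eq_smul_add]
    have b1 : c₁.1 ∈ ball (0 : R) r := by
      rw [mem_ball_zero_iff] at hc1 ⊢; exact (norm_fst_le _).trans_lt hc1
    have b2 : c₂.1 ∈ ball (0 : R) r := by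
      rw [mem_ball_zero_iff] at hc2 ⊢; exact (norm_fst_le _).trans_lt hc2
    rw [h.map_of_ball _ hm, hfst]
    have hmid := h.control_image.midpoint _ b1 _ b2
    rw [← show P x₁ = ψ c₁.1 from h.map_eq h1ρ, ← show P x₂ = ψ c₂.1 from h.map_eq h2ρ] at hmid
    refine hmid.trans ?_
    gcongr
    have : c₁.1 - c₂.1 = R.orthogonalProjectionOnto (P x₁ - P x₂) := by
      simp [hc₁, hc₂, adaptedCoord]
    rw [this]
    exact norm_orthogonalProjectionOnto_apply_le _ _

theorem exists_projection_image (h : IsUniformChart X P z R K φ ψ C r ρ)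
    (hX : IsManifoldAround 2 X z) (hPz : P z = z) :
    ∃ ε₀ > 0, ∀ ε, 0 < ε → ε < ε₀ → ∃ S : E → E,
      IsLipschitzMapFixing (closedBall z ε) (P '' (X ∩ closedBall z ε)) z S ∧
      ∀ y ∈ closedBall z ε, nearestPoints (P '' (X ∩ closedBall z ε)) y = {S y} := by
  obtain ⟨ρ₁, hρ₁, hcomp⟩ := hX.exists_isCompact (by norm_num)
  have hC1 := h.one_le
  have hC0 : 0 < C := zero_lt_one.trans_le hC1
  refine ⟨min (min ρ ρ₁) (1 / (64 * C ^ 3)), lt_min (lt_min h.ρ_pos hρ₁) (by positivity),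
    fun ε hε hε₀ => ?_⟩
  have hερ : ε < ρ := hε₀.trans_le ((min_le_left _ _).trans (min_le_left _ _))
  have hερ₁ : ε < ρ₁ := hε₀.trans_le ((min_le_left _ _).trans (min_le_right _ _))
  have hεC : ε * (64 * C ^ 3) < 1 :=
    (lt_div_iff₀ (by positivity)).1 (hε₀.trans_le (min_le_right _ _))
  have hzX : z ∈ X ∩ closedBall z ε := ⟨hX.1, mem_closedBall_self hε.le⟩
  have hsub : X ∩ closedBall z ε ⊆ X ∩ ball z ρ :=
    inter_subset_inter_right _ (closedBall_subset_ball hερ)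
  have hle : ε ≤ C * ε := le_mul_of_one_le_left hε.le hC1
  have hcont : ContinuousOn P (X ∩ closedBall z ε) := by
    refine (LipschitzOnWith.of_dist_le_mul (K := ⟨C, hC0.le⟩) fun x hx y hy => ?_).continuousOn
    rw [dist_eq_norm, dist_eq_norm]
    exact h.map_lipschitz x (hsub hx) y (hsub hy)
  have hMsub : P '' (X ∩ closedBall z ε) ⊆ closedBall z (C * ε) := by
    rintro _ ⟨x, hx, rfl⟩
    have h1 := h.map_lipschitz x (hsub hx) z (hsub hzX)
    have h2 := mem_closedBall.1 hx.2
    rw [hPz, ← dist_eq_norm, ← dist_eq_norm] at h1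
    exact h1.trans (by gcongr)
  have hC3 : C ^ 2 ≤ C ^ 3 := pow_le_pow_right₀ hC1 (by norm_num)
  obtain ⟨S, ⟨hS1, ⟨L, hS2⟩, hS3⟩, hS4⟩ := (h.isAlmostMidpointConvex_image hε hερ (by
    nlinarith [show 0 < ε * C ^ 3 by positivity])).exists_projection hC0.le
    (by nlinarith) hMsub ((hcomp z ε (closedBall_subset_ball hερ₁)).image_of_continuousOn hcont)
    ⟨z, hzX, hPz⟩
  have hbb := closedBall_subset_closedBall (x := z) hle
  exact ⟨S, ⟨hS1.mono_left hbb, ⟨L, hS2.mono hbb⟩, hS3⟩, fun y hy => hS4 y (hbb hy)⟩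

end IsUniformChart

/-- Enlarging a set away from its point `z` does not affect the points nearest to `y`, when `y` is
close to `z`. -/
theorem nearestPoints_eq_of_subset {G : Type*} [NormedAddCommGroup G] {M M' : Set G} {y z : G}
    (hMM : M' ⊆ M) (hz : z ∈ M')
    (hloc : ∀ w ∈ M, dist w z ≤ 2 * dist y z → w ∈ M') :
    nearestPoints M y = nearestPoints M' y := by
  have key : ∀ w ∈ M, dist y w ≤ dist y z → w ∈ M' := fun w hw hwz => by
    refine hloc w hw ?_
    have := dist_triangle_left w z y
    linarith
  ext p
  constructor
  · rintro ⟨hp, hmin⟩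
    exact ⟨key p hp (hmin z (hMM hz)), fun q hq => hmin q (hMM hq)⟩
  · rintro ⟨hp, hmin⟩
    refine ⟨hMM hp, fun q hq => ?_⟩
    rcases le_total (dist y q) (dist y z) with hqz | hqz
    · exact hmin q (key q hq hqz)
    · exact (hmin z hz).trans hqz

theorem IsUniformChart.exists_local_projection_image {X : Set E} {P : E → E} {z : E}
    {R K : Submodule ℝ E} {φ : R × K → E} {ψ : R → E} {C r ρ : ℝ}
    (h : IsUniformChart X P z R K φ ψ C r ρ) (hX : IsManifoldAround 2 X z) (hPz : P z = z)
    {W : Set E} (hW : W ∈ 𝓝 z) (hWρ : W ⊆ ball z ρ) :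
    ∃ V ∈ 𝓝 z, V ⊆ W ∧ ∃ S : E → E, IsLipschitzMapFixing V (P '' (X ∩ W)) z S ∧
      ∀ y ∈ V, nearestPoints (P '' (X ∩ W)) y = {S y} := by
  obtain ⟨ε₀, hε₀, hS⟩ := h.exists_projection_image hX hPz
  obtain ⟨ε₁, hε₁, hε₁W⟩ := Metric.nhds_basis_closedBall.mem_iff.1 hW
  set ε := min ε₁ (ε₀ / 2) with hε
  have hε0 : 0 < ε := lt_min hε₁ (by positivity)
  have hεW : closedBall z ε ⊆ W := (closedBall_subset_closedBall (min_le_left _ _)).trans hε₁W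
  obtain ⟨S, ⟨hS1, ⟨L, hS2⟩, hS3⟩, hS4⟩ := hS ε hε0 ((min_le_right _ _).trans_lt (by linarith))
  have hMM : P '' (X ∩ closedBall z ε) ⊆ P '' (X ∩ W) :=
    image_mono (inter_subset_inter_right _ hεW)
  obtain ⟨η, hη, hηball⟩ := Metric.eventually_nhds_iff_ball.1
    ((h.eventually_mem_image_iff (closedBall_mem_nhds z hε0) (hεW.trans hWρ)).and
      (h.eventually_mem_image_iff hW hWρ))
  set δ := min ε (η / 3) with hδ
  have hδε : closedBall z δ ⊆ closedBall z ε := closedBall_subset_closedBall (min_le_left _ _)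
  refine ⟨closedBall z δ, closedBall_mem_nhds z (lt_min hε0 (by positivity)), hδε.trans hεW, S,
    ⟨fun y hy => hMM (hS1 (hδε hy)), ⟨L, hS2.mono hδε⟩, hS3⟩, fun y hy => ?_⟩
  rw [← hS4 y (hδε hy)]
  refine nearestPoints_eq_of_subset hMM
    ⟨z, ⟨hX.1, mem_closedBall_self hε0.le⟩, hPz⟩ fun w hw hwz => ?_
  have h1 : dist y z ≤ η / 3 := (mem_closedBall.1 hy).trans (min_le_right _ _)
  have h2 : w ∈ ball z η := by rw [mem_ball]; linarith
  exact (hηball w h2).1.2 ((hηball w h2).2.1 hw)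

namespace IsUniformChart

variable {X : Set E} {P : E → E} {z : E} {R K : Submodule ℝ E} {φ : R × K → E} {ψ : R → E}
  {C r ρ : ℝ}

/-! ### Nearest points of the fibers -/

theorem norm_fderiv_chart_le (h : IsUniformChart X P z R K φ ψ C r ρ) {c : R × K}
    (hc : c ∈ ball (0 : R × K) r) : ‖fderiv ℝ φ c‖ ≤ C := by
  refine norm_fderiv_le_of_lip' ℝ (zero_le_one.trans h.one_le) ?_
  filter_upwards [isOpen_ball.mem_nhds hc] with c' hc'
  exact h.control_chart.lipschitz c' hc' c hc

/-- The `K`-part of the derivative of the chart along the fibers is the identity, so the derivative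
does not shrink vectors. -/
theorem norm_le_norm_fderiv_chart (h : IsUniformChart X P z R K φ ψ C r ρ) {c : R × K}
    (hc : c ∈ ball (0 : R × K) r) (v : K) : ‖v‖ ≤ ‖fderiv ℝ φ c (0, v)‖ := by
  have h1 : (K.orthogonalProjectionOnto).comp (fderiv ℝ φ c) = ContinuousLinearMap.snd ℝ R K := by
    refine ((K.orthogonalProjectionOnto).hasFDerivAt.comp c
      ((h.control_chart.differentiableAt c hc).hasFDerivAt.sub_const z)).unique
        (hasFDerivAt_snd.congr_of_eventuallyEq ?_)
    filter_upwards [isOpen_ball.mem_nhds hc] with c' hc'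
    exact h.proj_chart_of_ball c' hc'
  have h2 : K.orthogonalProjectionOnto (fderiv ℝ φ c (0, v)) = v := congrArg (fun L => L (0, v)) h1
  calc ‖v‖ = ‖K.orthogonalProjectionOnto (fderiv ℝ φ c (0, v))‖ := by rw [h2]
    _ ≤ _ := norm_orthogonalProjectionOnto_apply_le _ _

/-- First-order optimality of a nearest point of a fiber. -/
theorem inner_eq_zero_of_mem_nearestPoints (h : IsUniformChart X P z R K φ ψ C r ρ) {w p : E}
    (hp : p ∈ nearestPoints {x | x ∈ X ∧ P x = w} w) (hpρ : p ∈ ball z ρ) (v : K) :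
    inner ℝ (p - w) (fderiv ℝ φ (adaptedCoord P z R K p) (0, v)) = 0 := by
  have hpX : p ∈ X ∩ ball z ρ := ⟨hp.1.1, hpρ⟩
  have hc := h.coord_mem p hpX
  have hφp := h.chart_coord_of_ball p hpX
  set c := adaptedCoord P z R K p with hcdef
  clear_value c
  set f : K → ℝ := fun b => ‖φ (c.1, b) - w‖ ^ 2 with hf
  have hin : HasFDerivAt (fun b : K => (c.1, b)) (ContinuousLinearMap.inr ℝ R K) c.2 :=
    hasFDerivAt_prodMk_right c.1 c.2
  have hd := (HasFDerivAt.comp c.2 (g := φ)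
    (h.control_chart.differentiableAt c hc).hasFDerivAt hin).sub_const w
  have hmin : IsLocalMin f c.2 := by
    have hball : ∀ᶠ b in 𝓝 c.2, (c.1, b) ∈ ball (0 : R × K) r :=
      hin.continuousAt.eventually (isOpen_ball.mem_nhds hc)
    filter_upwards [hball] with b hb
    have h1 : P (φ (c.1, b)) = w :=
      (h.map_of_ball _ hb).trans ((h.map_of_ball c hc).symm.trans (by rw [hφp]; exact hp.1.2))
    have h2 := hp.2 (φ (c.1, b)) ⟨h.mem_of_ball _ hb, h1⟩
    rw [dist_eq_norm', dist_eq_norm'] at h2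
    have h3 : f c.2 = ‖p - w‖ ^ 2 := by simp only [hf, Prod.mk.eta, hφp]
    rw [h3]
    exact pow_le_pow_left₀ (norm_nonneg _) h2 2
  have hz := hmin.hasFDerivAt_eq_zero hd.norm_sq
  have := congrArg (fun L => L v) hz
  have hφp' : φ (c.1, c.2) = p := hφp
  simpa [hφp', ← inner_sub_left] using this

/-- The point of the fiber over `w` that is nearest to `w` depends on `w` in a Lipschitz way. The
first-order conditions at two such points are tested with the difference of their fiber coordinates
and subtracted; near `z` the error terms are absorbed by the square of that difference. -/
theorem dist_nearestPoints_fiber_le (h : IsUniformChart X P z R K φ ψ C r ρ) {σ : ℝ}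
    (hσ : σ * (2 * C + 2 * C ^ 3) ≤ 1 / 2) {w₁ w₂ p₁ p₂ : E}
    (hp₁ : p₁ ∈ nearestPoints {x | x ∈ X ∧ P x = w₁} w₁) (hp₁ρ : p₁ ∈ ball z ρ)
    (hp₂ : p₂ ∈ nearestPoints {x | x ∈ X ∧ P x = w₂} w₂) (hp₂ρ : p₂ ∈ ball z ρ)
    (hpw : ‖p₂ - w₂‖ ≤ 2 * σ) (hpp : ‖p₁ - p₂‖ ≤ 2 * σ) :
    ‖p₁ - p₂‖ ≤ C * (2 * C + 2 * C ^ 2 + 2) * ‖w₁ - w₂‖ := by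
  have hC1 := h.one_le
  have hC0 : 0 < C := zero_lt_one.trans_le hC1
  have h₁ : p₁ ∈ X ∩ ball z ρ := ⟨hp₁.1.1, hp₁ρ⟩
  have h₂ : p₂ ∈ X ∩ ball z ρ := ⟨hp₂.1.1, hp₂ρ⟩
  have hc₁ := h.coord_mem p₁ h₁
  have hc₂ := h.coord_mem p₂ h₂
  have e₁ := h.chart_coord_of_ball p₁ h₁
  have e₂ := h.chart_coord_of_ball p₂ h₂
  have hcc := h.coord_lipschitz p₁ h₁ p₂ h₂
  have o₁ := h.inner_eq_zero_of_mem_nearestPoints hp₁ hp₁ρ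
  have o₂ := h.inner_eq_zero_of_mem_nearestPoints hp₂ hp₂ρ
  have hΔa : (adaptedCoord P z R K p₁).1 - (adaptedCoord P z R K p₂).1 =
      R.orthogonalProjectionOnto (w₁ - w₂) := by
    have a1 : P p₁ = w₁ := hp₁.1.2
    have a2 : P p₂ = w₂ := hp₂.1.2
    simp [adaptedCoord, a1, a2]
  set c₁ := adaptedCoord P z R K p₁ with hc₁def
  set c₂ := adaptedCoord P z R K p₂ with hc₂def
  set D₁ := fderiv ℝ φ c₁ with hD₁
  set D₂ := fderiv ℝ φ c₂ with hD₂
  set v : K := c₁.2 - c₂.2 with hv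
  set δ := ‖w₁ - w₂‖ with hδ
  set n := ‖v‖ with hn
  have hδ0 : 0 ≤ δ := norm_nonneg _
  have hn0 : 0 ≤ n := norm_nonneg _
  have hav : ‖c₁.1 - c₂.1‖ ≤ δ := by
    rw [hΔa]; exact norm_orthogonalProjectionOnto_apply_le _ _
  have hcn : ‖c₁ - c₂‖ ≤ δ + n := by
    rw [Prod.norm_def]
    exact max_le (by rw [Prod.fst_sub]; linarith) (by rw [Prod.snd_sub, ← hv, ← hn]; linarith)
  have hsplit : c₁ - c₂ = (c₁.1 - c₂.1, 0) + (0, v) := by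
    ext <;> simp [hv]
  -- the error of the linearization of the chart at `c₁`
  set T := φ c₂ - φ c₁ - D₁ (c₂ - c₁) with hT
  have hTn : ‖T‖ ≤ C * ‖c₁ - c₂‖ ^ 2 := by
    rw [norm_sub_rev c₁]; exact h.control_chart.taylor c₂ hc₂ c₁ hc₁
  have hpeq : p₁ - p₂ = D₁ (c₁.1 - c₂.1, 0) + D₁ (0, v) - T := by
    rw [← map_add, ← hsplit, hT, e₁, e₂, ← neg_sub c₁ c₂, map_neg]
    abel
  set u := D₁ (0, v) with hu
  have hnu : n ≤ ‖u‖ := h.norm_le_norm_fderiv_chart hc₁ v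
  have hD₁n : ‖D₁‖ ≤ C := h.norm_fderiv_chart_le hc₁
  have hev : ‖((0 : R), v)‖ = n := by simp [Prod.norm_def, hn]
  have hun : ‖u‖ ≤ C * n := by
    refine (D₁.le_of_opNorm_le hD₁n _).trans_eq ?_
    rw [hev]
  have hwn : ‖D₁ (c₁.1 - c₂.1, 0)‖ ≤ C * δ := by
    refine (D₁.le_of_opNorm_le hD₁n _).trans ?_
    gcongr
    simpa [Prod.norm_def] using hav
  have hDDn : ‖(D₁ - D₂) (0, v)‖ ≤ C * ‖c₁ - c₂‖ * n := by
    refine ((D₁ - D₂).le_of_opNorm_le (h.control_chart.fderiv_sub_le c₁ hc₁ c₂ hc₂) _).trans_eq ?_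
    rw [hev]
  have key : ‖u‖ ^ 2 = inner ℝ (w₁ - w₂) u - inner ℝ (p₂ - w₂) ((D₁ - D₂) (0, v)) -
      inner ℝ (D₁ (c₁.1 - c₂.1, 0)) u + inner ℝ T u := by
    have a1 : inner ℝ (p₁ - w₁) u = 0 := o₁ v
    have a2 : inner ℝ (p₂ - w₂) (D₂ (0, v)) = 0 := o₂ v
    have a3 : inner ℝ (p₁ - p₂) u = inner ℝ (D₁ (c₁.1 - c₂.1, 0)) u + ‖u‖ ^ 2 - inner ℝ T u := by
      rw [hpeq, inner_sub_left, inner_add_left, real_inner_self_eq_norm_sq]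
    have a4 : inner ℝ (p₂ - w₂) ((D₁ - D₂) (0, v)) = inner ℝ (p₂ - w₂) u := by
      rw [sub_apply, inner_sub_right, a2, sub_zero]
    rw [inner_sub_left] at a1 a3
    rw [a4, inner_sub_left, inner_sub_left]
    linarith
  have i1 : inner ℝ (w₁ - w₂) u ≤ δ * (C * n) := (real_inner_le_norm _ _).trans (by gcongr)
  have hmn : ‖c₁ - c₂‖ ≤ 2 * C * σ := by nlinarith
  have hσ0 : 0 ≤ σ := by have := norm_nonneg (p₁ - p₂); linarith
  have i2 : -inner ℝ (p₂ - w₂) ((D₁ - D₂) (0, v)) ≤ 2 * σ * (C * (δ + n) * n) := by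
    refine (neg_le_abs _).trans ((abs_real_inner_le_norm _ _).trans ?_)
    exact mul_le_mul hpw (hDDn.trans (by gcongr)) (norm_nonneg _) (by positivity)
  have i3 : -inner ℝ (D₁ (c₁.1 - c₂.1, 0)) u ≤ C * δ * (C * n) := by
    refine (neg_le_abs _).trans ((abs_real_inner_le_norm _ _).trans ?_)
    gcongr
  have i4 : inner ℝ T u ≤ C * (2 * C * σ * (δ + n)) * (C * n) := by
    refine (real_inner_le_norm _ _).trans ?_
    refine mul_le_mul (hTn.trans ?_) hun (norm_nonneg _) (by positivity)
    rw [sq]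
    gcongr
  have hle : n * n ≤ n * ((C + C ^ 2) * δ + 1 / 2 * (δ + n)) := by
    have : n ^ 2 ≤ ‖u‖ ^ 2 := pow_le_pow_left₀ hn0 hnu 2
    have h5 : σ * (2 * C + 2 * C ^ 3) * ((δ + n) * n) ≤ 1 / 2 * ((δ + n) * n) := by gcongr
    nlinarith
  have hfin : n ≤ (2 * C + 2 * C ^ 2 + 1) * δ := by
    rcases hn0.eq_or_lt with h0 | h0
    · rw [← h0]; positivity
    · have := le_of_mul_le_mul_left hle h0
      linarith
  have hlast := h.control_chart.lipschitz c₁ hc₁ c₂ hc₂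
  rw [e₁, e₂] at hlast
  refine hlast.trans ?_
  rw [mul_assoc]
  gcongr
  linarith

/-- The nearest points of the fibers define a Lipschitz local section of `P`. -/
theorem exists_fiber_projection (h : IsUniformChart X P z R K φ ψ C r ρ)
    (hX : IsManifoldAround 2 X z) (hPz : P z = z) :
    ∃ σ > 0, ∃ Q : E → E, IsLipschitzMapFixing (P '' (X ∩ ball z σ) ∩ ball z σ) X z Q ∧
      (∀ w ∈ P '' (X ∩ ball z σ) ∩ ball z σ, P (Q w) = w) ∧
      ∀ w ∈ P '' (X ∩ ball z σ) ∩ ball z σ, nearestPoints {x | x ∈ X ∧ P x = w} w = {Q w} := by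
  obtain ⟨ρ₁, hρ₁, hcomp⟩ := hX.exists_isCompact (by norm_num)
  have hC0 : 0 < C := zero_lt_one.trans_le h.one_le
  -- the nearest points lie within `3 σ` of `z`: this radius has to fit into the chart and into the
  -- region where `X` is locally closed, and to satisfy `dist_nearestPoints_fiber_le`
  set τ := min (min (ρ / 3) (ρ₁ / 3)) (1 / (6 * C + 6 * C ^ 3)) with hτ
  have hτ0 : 0 < τ :=
    lt_min (lt_min (by linarith [h.ρ_pos]) (by positivity)) (by positivity)
  have hτρ : 3 * τ ≤ ρ := by
    have : τ ≤ ρ / 3 := (min_le_left _ _).trans (min_le_left _ _)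
    linarith
  have hτρ₁ : 3 * τ ≤ ρ₁ := by
    have : τ ≤ ρ₁ / 3 := (min_le_left _ _).trans (min_le_right _ _)
    linarith
  have hτC : τ * (6 * C + 6 * C ^ 3) ≤ 1 := (le_div_iff₀ (by positivity)).1 (min_le_right _ _)
  set σ := τ / 2 with hσ
  have hσ0 : 0 < σ := by positivity
  set M := P '' (X ∩ ball z σ) ∩ ball z σ with hM
  set G : E → Set E := fun w => {x | x ∈ X ∧ P x = w} with hG
  have hnear : ∀ w ∈ M, ∀ p ∈ nearestPoints (G w) w, ‖p - w‖ ≤ 2 * σ ∧ ‖p - z‖ < 3 * σ := by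
    rintro w ⟨⟨x, ⟨hxX, hx⟩, hxw⟩, hw⟩ p hp
    have h1 := hp.2 x ⟨hxX, hxw⟩
    have h2 := dist_triangle_right w x z
    have h3 := dist_triangle p w z
    rw [mem_ball] at hx hw
    rw [dist_comm p w] at h3
    rw [← dist_eq_norm, ← dist_eq_norm, dist_comm p w]
    constructor <;> linarith
  have hex : ∀ w ∈ M, ∃ p, p ∈ nearestPoints (G w) w := by
    rintro w ⟨⟨x, ⟨hxX, hx⟩, hxw⟩, hw⟩
    have hxw' : dist w x ≤ 2 * σ := by
      have h2 := dist_triangle_right w x z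
      rw [mem_ball] at hx hw
      linarith
    have hsub : closedBall w (2 * σ) ⊆ ball z (3 * τ) := fun y hy => by
      have := dist_triangle y w z
      rw [mem_closedBall] at hy
      rw [mem_ball] at hw ⊢
      linarith
    have hcont : ContinuousOn P (X ∩ closedBall w (2 * σ)) := by
      refine (LipschitzOnWith.of_dist_le_mul (K := ⟨C, hC0.le⟩) fun x hx y hy => ?_).continuousOn
      rw [dist_eq_norm, dist_eq_norm]
      exact h.map_lipschitz x ⟨hx.1, ball_subset_ball hτρ (hsub hx.2)⟩ y
        ⟨hy.1, ball_subset_ball hτρ (hsub hy.2)⟩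
    have hA := hcomp w (2 * σ) (hsub.trans (ball_subset_ball hτρ₁))
    have hcl : IsCompact ((X ∩ closedBall w (2 * σ)) ∩ P ⁻¹' {w}) :=
      hA.of_isClosed_subset (hcont.preimage_isClosed_of_isClosed hA.isClosed isClosed_singleton)
        inter_subset_left
    obtain ⟨p, hp, hmin⟩ := hcl.exists_isMinOn
      ⟨x, ⟨hxX, by rw [mem_closedBall, dist_comm]; exact hxw'⟩, hxw⟩
      (f := fun q => dist w q) (continuous_const.dist continuous_id).continuousOn
    refine ⟨p, ⟨hp.1.1, hp.2⟩, fun q hq => ?_⟩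
    by_cases hqb : dist w q ≤ 2 * σ
    · exact hmin ⟨⟨hq.1, by rw [mem_closedBall, dist_comm]; exact hqb⟩, hq.2⟩
    · have := mem_closedBall.1 hp.1.2
      rw [dist_comm] at this
      linarith
  have key : ∀ w₁ ∈ M, ∀ w₂ ∈ M, ∀ p₁ ∈ nearestPoints (G w₁) w₁, ∀ p₂ ∈ nearestPoints (G w₂) w₂,
      ‖p₁ - p₂‖ ≤ C * (2 * C + 2 * C ^ 2 + 2) * ‖w₁ - w₂‖ := by
    intro w₁ hw₁ w₂ hw₂ p₁ hp₁ p₂ hp₂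
    obtain ⟨a₁, b₁⟩ := hnear w₁ hw₁ p₁ hp₁
    obtain ⟨a₂, b₂⟩ := hnear w₂ hw₂ p₂ hp₂
    have hpp : ‖p₁ - p₂‖ ≤ 3 * τ := by
      have := norm_sub_le_norm_sub_add_norm_sub p₁ z p₂
      rw [norm_sub_rev z] at this
      linarith
    refine h.dist_nearestPoints_fiber_le (σ := 3 / 2 * τ) (by nlinarith) hp₁ ?_ hp₂ ?_
      (by linarith) (by linarith)
    · rw [mem_ball, dist_eq_norm]; linarith
    · rw [mem_ball, dist_eq_norm]; linarith
  have hex' : ∀ w, ∃ p, w ∈ M → p ∈ nearestPoints (G w) w := fun w => by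
    by_cases hw : w ∈ M
    · exact (hex w hw).imp fun p hp _ => hp
    · exact ⟨z, fun hw' => absurd hw' hw⟩
  choose Q hQ using hex'
  refine ⟨σ, hσ0, Q, ⟨fun w hw => (hQ w hw).1.1, ⟨⟨C * (2 * C + 2 * C ^ 2 + 2), by positivity⟩,
    LipschitzOnWith.of_dist_le_mul fun w₁ hw₁ w₂ hw₂ => ?_⟩, ?_⟩, fun w hw => (hQ w hw).1.2,
    fun w hw => Subset.antisymm (fun p hp => ?_) (singleton_subset_iff.2 (hQ w hw))⟩
  · rw [dist_eq_norm, dist_eq_norm]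
    exact key w₁ hw₁ w₂ hw₂ _ (hQ w₁ hw₁) _ (hQ w₂ hw₂)
  · have hzM : z ∈ M := ⟨⟨z, ⟨hX.1, mem_ball_self hσ0⟩, hPz⟩, mem_ball_self hσ0⟩
    have := (hQ z hzM).2 z ⟨hX.1, hPz⟩
    rw [dist_self, dist_le_zero] at this
    exact this.symm
  · have := key w hw w hw p hp (Q w) (hQ w hw)
    rw [sub_self, norm_zero, mul_zero] at this
    exact sub_eq_zero.1 (norm_le_zero_iff.1 this)

end IsUniformChart

/-! ### Tangent spaces of one manifold meeting the other manifold -/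

/-- At an isolated transversal intersection point, the derivatives of the two systems of equations
form together a linear isomorphism. -/
theorem exists_equiv_of_isolated_transversal {X Y : Set E} {z : E} (hzX : z ∈ X) (hzY : z ∈ Y)
    {m l : ℕ} {F : E → EuclideanSpace ℝ (Fin m)} {H : E → EuclideanSpace ℝ (Fin l)}
    (hF : IsLocalEquation 2 X z F) (hH : IsLocalEquation 2 Y z H)
    (hisolated : ∀ᶠ x in 𝓝 z, x ∈ X ∩ Y → x = z)
    (htransversal : normalSpace X z ⊓ normalSpace Y z = ⊥) :
    ∃ e : E ≃L[ℝ] EuclideanSpace ℝ (Fin m) × EuclideanSpace ℝ (Fin l),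
      ∀ v, e v = (fderiv ℝ F z v, fderiv ℝ H z v) := by
  set B := (fderiv ℝ F z).prod (fderiv ℝ H z) with hB
  have hsup : (fderiv ℝ F z).toLinearMap.ker ⊔ (fderiv ℝ H z).toLinearMap.ker = ⊤ := by
    rw [normalSpace_eq hzX hF.eventually_one.self_of_nhds,
      normalSpace_eq hzY hH.eventually_one.self_of_nhds, range_adjoint_eq, range_adjoint_eq,
      Submodule.inf_orthogonal] at htransversal
    exact (Submodule.orthogonal_eq_bot_iff).1 htransversal
  have hsur : B.range = ⊤ := by
    refine LinearMap.range_eq_top.2 ?_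
    rintro ⟨u, v⟩
    obtain ⟨a, ha⟩ := hF.surjective u
    obtain ⟨b, hb⟩ := hH.surjective v
    obtain ⟨s, hs, t, ht, hst⟩ := Submodule.mem_sup.1 (hsup ▸ Submodule.mem_top : a - b ∈ _)
    have hs' : fderiv ℝ F z s = 0 := hs
    have ht' : fderiv ℝ H z t = 0 := ht
    have hab : a - s = b + t := by
      rw [sub_eq_iff_eq_add, add_assoc, add_comm t s, hst]; abel
    refine ⟨a - s, Prod.ext ?_ ?_⟩
    · change fderiv ℝ F z (a - s) = u
      rw [map_sub, hs', sub_zero, ha]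
    · change fderiv ℝ H z (a - s) = v
      rw [hab, map_add, ht', add_zero, hb]
  have hinj : B.ker = ⊥ := by
    -- a kernel vector is tangent to a curve in the intersection, which is constant
    have hsB : HasStrictFDerivAt (fun x => (F x, H x)) B z :=
      (hF.contDiffAt_two.hasStrictFDerivAt (by norm_num)).prodMk
        (hH.contDiffAt_two.hasStrictFDerivAt (by norm_num))
    set γ := hsB.implicitFunction (fun x => (F x, H x)) B hsur (F z, H z) with hγ
    have hd : HasStrictFDerivAt γ B.ker.subtypeL 0 := hsB.to_implicitFunction hsur
    have h0 : γ 0 = z := hsB.implicitFunction_apply_image hsur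
    have hcont : Tendsto γ (𝓝 0) (𝓝 z) := by
      have := hd.hasFDerivAt.continuousAt.tendsto
      rwa [h0] at this
    have hpair : Tendsto (fun t : B.ker => ((F z, H z), t)) (𝓝 0) (𝓝 ((F z, H z), 0)) :=
      tendsto_const_nhds.prodMk_nhds tendsto_id
    have hconst : γ =ᶠ[𝓝 0] fun _ => z := by
      filter_upwards [hpair.eventually (hsB.map_implicitFunction_eq hsur),
        hcont.eventually hF.eventually_iff, hcont.eventually hH.eventually_iff,
        hcont.eventually hisolated] with t a b c d
      have a1 : F (γ t) = F z := congrArg Prod.fst a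
      have a2 : H (γ t) = H z := congrArg Prod.snd a
      exact d ⟨b.2 (a1.trans (hF.eventually_iff.self_of_nhds.1 hzX)),
        c.2 (a2.trans (hH.eventually_iff.self_of_nhds.1 hzY))⟩
    have h4 := hd.hasFDerivAt.unique ((hasFDerivAt_const z _).congr_of_eventuallyEq hconst)
    refine (Submodule.eq_bot_iff _).2 fun v hv => ?_
    exact congrArg (fun L : B.ker →L[ℝ] E => L ⟨v, hv⟩) h4
  exact ⟨ContinuousLinearEquiv.ofBijective B hinj hsur, fun v => rfl⟩

/-- The affine tangent space of `X` at a point `x` near `z` meets `Y` in exactly one point near `z`,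
and this point is quadratically closer to `z` than `x`. -/
theorem exists_tangent_intersection {X Y : Set E} {z : E} (hX : IsManifoldAround 2 X z)
    (hY : IsManifoldAround 2 Y z) (hisolated : ∀ᶠ x in 𝓝 z, x ∈ X ∩ Y → x = z)
    (htransversal : normalSpace X z ⊓ normalSpace Y z = ⊥) :
    ∃ ρ > 0, ∃ C ≥ 0, ∀ x ∈ X ∩ ball z ρ, ∃ y ∈ Y, y - x ∈ tangentSpace X x ∧
      dist y z ≤ C * dist x z ^ 2 ∧ dist y z ≤ dist x z ∧
      ∀ y' ∈ Y ∩ ball z ρ, y' - x ∈ tangentSpace X x → y' = y := by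
  obtain ⟨hzX, m, F, hF⟩ := hX
  obtain ⟨hzY, l, H, hH⟩ := hY
  obtain ⟨e, he⟩ := exists_equiv_of_isolated_transversal hzX hzY hF hH hisolated htransversal
  obtain ⟨C, hC, r₁, hr₁, hFq⟩ := exists_quadraticControl hF.contDiffAt_two
  -- a bound of the inverse of `e`, made positive for the case of a trivial space
  set κ : ℝ≥0 :=
    ‖(e.symm : EuclideanSpace ℝ (Fin m) × EuclideanSpace ℝ (Fin l) →L[ℝ] E)‖₊ + 1 with hκ
  have hκ0 : (0 : ℝ) < κ := by rw [hκ]; positivity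
  set c : ℝ≥0 := (2 * κ)⁻¹ with hc
  have hcκ : (c : ℝ) * (2 * κ) = 1 := by
    rw [hc]; push_cast; field_simp
  have hc0 : (0 : ℝ) < c := by rw [hc]; positivity
  have hinv : ∀ u, ‖e.symm u‖ ≤ κ * ‖u‖ := fun u => by
    refine ((e.symm : EuclideanSpace ℝ (Fin m) × EuclideanSpace ℝ (Fin l) →L[ℝ] E).le_opNorm
      u).trans ?_
    gcongr
    rw [hκ]; push_cast; linarith
  have hinv' : ∀ v, ‖v‖ ≤ κ * ‖e v‖ := fun v => by simpa using hinv (e v)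
  obtain ⟨s, hs, hsH⟩ := (hH.contDiffAt_two.hasStrictFDerivAt
    (by norm_num)).approximates_deriv_on_nhds (c := c) (Or.inr (by exact_mod_cast hc0))
  obtain ⟨r₂, hr₂, hb₂⟩ := Metric.mem_nhds_iff.1 (inter_mem hs hH.eventually_iff)
  obtain ⟨r₃, hr₃, hb₃⟩ := Metric.mem_nhdsWithin_iff.1
    (inter_mem hF.eventually_tangentSpace_eq (nhdsWithin_le_nhds hF.eventually_iff))
  set ρ := min (min r₁ (r₂ / 2)) (min r₃ (c / C)) with hρ
  have hρ0 : 0 < ρ := lt_min (lt_min hr₁ (by positivity)) (lt_min hr₃ (by positivity))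
  have hρ₁ : ρ ≤ r₁ := (min_le_left _ _).trans (min_le_left _ _)
  have hρ₂ : ρ ≤ r₂ / 2 := (min_le_left _ _).trans (min_le_right _ _)
  have hρ₃ : ρ ≤ r₃ := (min_le_right _ _).trans (min_le_left _ _)
  have hρC : C * ρ ≤ c := by
    have : ρ ≤ c / C := (min_le_right _ _).trans (min_le_right _ _)
    rw [le_div_iff₀ hC] at this
    linarith
  refine ⟨ρ, hρ0, 2 * κ * C, by positivity, fun x ⟨hxX, hxρ⟩ => ?_⟩
  have hx3 := hb₃ ⟨ball_subset_ball hρ₃ hxρ, hxX⟩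
  have htan : tangentSpace X x = (fderiv ℝ F x).toLinearMap.ker := hx3.1
  have hFx : F x = 0 := hx3.2.1 hxX
  have hFz : F z = 0 := hF.eventually_iff.self_of_nhds.1 hzX
  have hHz : H z = 0 := hH.eventually_iff.self_of_nhds.1 hzY
  have hxr₁ : x ∈ ball z r₁ := ball_subset_ball hρ₁ hxρ
  have hxd : ‖x - z‖ < ρ := by rw [← dist_eq_norm]; exact hxρ
  -- the zeros of `f` are the points to be found
  set f : E → EuclideanSpace ℝ (Fin m) × EuclideanSpace ℝ (Fin l) :=
    fun y => (fderiv ℝ F x (y - x), H y) with hf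
  have hfapp : ApproximatesLinearOn f (e : E →L[ℝ] _) (ball z r₂) c := by
    intro y hy y' hy'
    have h1 : f y - f y' - (e : E →L[ℝ] _) (y - y') =
        ((fderiv ℝ F x - fderiv ℝ F z) (y - y'), H y - H y' - fderiv ℝ H z (y - y')) := by
      rw [ContinuousLinearEquiv.coe_coe, he]
      refine Prod.ext ?_ rfl
      simp only [hf, Prod.fst_sub, sub_apply, map_sub]
      abel
    rw [h1, Prod.norm_def]
    refine max_le ?_ (hsH y (hb₂ hy).1 y' (hb₂ hy').1)
    refine (ContinuousLinearMap.le_of_opNorm_le _ (hFq.fderiv_sub_le x hxr₁ z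
      (mem_ball_self hr₁)) _).trans ?_
    gcongr
    exact (mul_le_mul_of_nonneg_left hxd.le hC.le).trans hρC
  have hclose : ∀ y ∈ ball z r₂, ∀ y' ∈ ball z r₂, ‖y - y'‖ ≤ 2 * κ * ‖f y - f y'‖ := by
    intro y hy y' hy'
    have h1 := hfapp y hy y' hy'
    have h2 := hinv' (y - y')
    have h3 : ‖e (y - y')‖ ≤ ‖f y - f y'‖ + c * ‖y - y'‖ := by
      have := norm_sub_le (f y - f y') (f y - f y' - e (y - y'))
      rw [sub_sub_cancel] at this
      exact this.trans (by gcongr; exact h1)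
    have h4 : (κ : ℝ) * (c * ‖y - y'‖) = 1 / 2 * ‖y - y'‖ := by
      linear_combination 1 / 2 * ‖y - y'‖ * hcκ
    nlinarith [mul_le_mul_of_nonneg_left h3 hκ0.le]
  have hfz : ‖f z‖ ≤ C * ‖x - z‖ ^ 2 := by
    have := hFq.taylor z (mem_ball_self hr₁) x hxr₁
    rw [hFz, hFx, sub_zero, zero_sub, norm_neg, norm_sub_rev z x] at this
    simp only [hf, hHz, Prod.norm_def, norm_zero]
    exact max_le this (by positivity)
  have hfz' : 2 * κ * ‖f z‖ ≤ ‖x - z‖ := by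
    have h1 : ‖f z‖ ≤ c * ‖x - z‖ := by
      refine hfz.trans ?_
      rw [sq, ← mul_assoc]
      gcongr
      exact (mul_le_mul_of_nonneg_left hxd.le hC.le).trans hρC
    nlinarith [mul_le_mul_of_nonneg_left h1 hκ0.le]
  have hsurj := hfapp.surjOn_closedBall_of_nonlinearRightInverse
    { toFun := e.symm, nnnorm := κ, bound' := hinv, right_inv' := e.apply_symm_apply }
    (ε := r₂ / 2) (b := z) (by positivity) (closedBall_subset_ball (by linarith))
  obtain ⟨y, hy, hfy⟩ := hsurj (show 0 ∈ _ by
    rw [mem_closedBall, dist_eq_norm, zero_sub, norm_neg]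
    change ‖f z‖ ≤ ((κ : ℝ)⁻¹ - c) * (r₂ / 2)
    have h1 : (κ : ℝ)⁻¹ = 2 * c := by
      rw [inv_eq_one_div, div_eq_iff hκ0.ne']; linarith
    rw [h1]
    have h2 : c * (2 * κ * ‖f z‖) ≤ c * (r₂ / 2) := by gcongr; linarith
    rw [← mul_assoc, hcκ] at h2
    linarith)
  have hyr : y ∈ ball z r₂ := closedBall_subset_ball (by linarith) hy
  have hzr : z ∈ ball z r₂ := mem_ball_self hr₂
  have hyz := hclose y hyr z hzr
  rw [hfy, zero_sub, norm_neg] at hyz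
  have hyY : y ∈ Y := (hb₂ hyr).2.2 (congrArg Prod.snd hfy)
  refine ⟨y, hyY, ?_, ?_, ?_, ?_⟩
  · rw [htan]; exact congrArg Prod.fst hfy
  · rw [dist_eq_norm, dist_eq_norm, mul_assoc]
    exact hyz.trans (by gcongr)
  · rw [dist_eq_norm, dist_eq_norm]; exact hyz.trans hfz'
  · rintro y' ⟨hy'Y, hy'⟩ hy't
    rw [htan] at hy't
    have hy'r : y' ∈ ball z r₂ := ball_subset_ball (by linarith) hy'
    have hfy' : f y' = 0 := Prod.ext hy't ((hb₂ hy'r).2.1 hy'Y)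
    have := hclose y' hy'r y hyr
    rw [hfy, hfy', sub_self, norm_zero, mul_zero] at this
    exact sub_eq_zero.1 (norm_le_zero_iff.1 this)

end ManifoldIntersection

open ManifoldIntersection

theorem mainTheorem1 {E : Type*} [NormedAddCommGroup E] [InnerProductSpace ℝ E]
    [FiniteDimensional ℝ E] (X Y : Set E) (z : E)
    (hX : ManifoldIntersection.IsManifoldAround 2 X z)
    (hY : ManifoldIntersection.IsManifoldAround 2 Y z)
    (hisolated : ∀ᶠ x in 𝓝 z, x ∈ X ∩ Y → x = z)
    (htransversal :
      ManifoldIntersection.normalSpace X z ⊓ ManifoldIntersection.normalSpace Y z = ⊥)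
    (P : E → E) (hPmaps : MapsTo P X Y) (hPz : P z = z)
    (hP : ManifoldIntersection.IsSmoothOfConstantRankNear 2 X P z) :
    ∃ W₀ ∈ 𝓝 z, ∀ W ∈ 𝓝 z, W ⊆ W₀ → ∀ M : Set E, M = P '' (X ∩ W) →
      -- (a) the image is a manifold
      (M ⊆ Y ∧ ManifoldIntersection.IsManifoldAround 2 M z) ∧
      -- (b) existence of `S`
      (∃ S : E → E, ManifoldIntersection.IsLipschitzMapFixing (Y ∩ W) M z S) ∧
      -- (b) the choice `S = Proj_M`, near `z`, and on all of `Y ∩ W` if `W` is a closed ball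
      (∃ V ∈ 𝓝 z, V ⊆ W ∧ ∃ S : E → E,
        ManifoldIntersection.IsLipschitzMapFixing (Y ∩ V) M z S ∧
        ∀ y ∈ Y ∩ V, ManifoldIntersection.nearestPoints M y = {S y}) ∧
      ((∃ ε : ℝ, W = closedBall z ε) → ∃ S : E → E,
        ManifoldIntersection.IsLipschitzMapFixing (Y ∩ W) M z S ∧
        ∀ y ∈ Y ∩ W, ManifoldIntersection.nearestPoints M y = {S y}) ∧
      -- (c) existence of `Q`
      (∃ Q : E → E, ManifoldIntersection.IsLipschitzMapFixing (M ∩ W) X z Q ∧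
        ∀ w ∈ M ∩ W, P (Q w) = w) ∧
      -- (c) the choice `Q(w) = Proj_{P⁻¹(w)}(w)`
      (∃ Q : E → E, ManifoldIntersection.IsLipschitzMapFixing (M ∩ W) X z Q ∧
        (∀ w ∈ M ∩ W, P (Q w) = w) ∧
        ∀ w ∈ M ∩ W, ManifoldIntersection.nearestPoints {x | x ∈ X ∧ P x = w} w = {Q w}) ∧
      -- (d) at most one point `y(x)` for all `x ∈ X ∩ W`, exactly one for `x ∈ X` near `z`,
      -- and exactly one for all `x ∈ X ∩ W` if `W` is a ball
      (∀ x ∈ X ∩ W, {y | y ∈ Y ∩ W ∧ y - x ∈ ManifoldIntersection.tangentSpace X x}.Subsingleton) ∧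
      (∀ᶠ x in 𝓝[X] z, ∃! y, y ∈ Y ∩ W ∧ y - x ∈ ManifoldIntersection.tangentSpace X x) ∧
      ((∃ ε : ℝ, W = closedBall z ε ∨ W = ball z ε) →
        ∀ x ∈ X ∩ W, ∃! y, y ∈ Y ∩ W ∧ y - x ∈ ManifoldIntersection.tangentSpace X x) ∧
      -- quadratic convergence, for `y(·)` from (d) and all `S`, `Q` as in (b), (c)
      (∀ y S Q : E → E,
        (∀ᶠ x in 𝓝[X] z, y x ∈ Y ∩ W ∧ y x - x ∈ ManifoldIntersection.tangentSpace X x) →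
        ∀ V ∈ 𝓝 z, V ⊆ W →
        ManifoldIntersection.IsLipschitzMapFixing (Y ∩ V) M z S →
        ManifoldIntersection.IsLipschitzMapFixing (M ∩ W) X z Q →
        (∀ w ∈ M ∩ W, P (Q w) = w) →
        ∃ δ > 0, ∃ C : ℝ, ∀ x : ℕ → E, x 0 ∈ X → dist (x 0) z < δ →
          (∀ k, x (k + 1) = Q (S (y (x k)))) →
          (∀ k, x k ∈ X ∩ W ∧ y (x k) ∈ Y ∩ V ∧
            y (x k) - x k ∈ ManifoldIntersection.tangentSpace X (x k) ∧
            S (y (x k)) ∈ M ∩ W) ∧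
          Tendsto x atTop (𝓝 z) ∧
          ∀ k, dist (x (k + 1)) z ≤ C * dist (x k) z ^ 2) := by

  obtain ⟨R, K, φ, ψ, hchart⟩ := exists_isAdaptedChart hX hPz hP
  obtain ⟨C, r, ρ₁, h⟩ := hchart.exists_isUniformChart hX.1 hPz
  obtain ⟨ρ₂, hρ₂, hproj⟩ := h.exists_projection_image hX hPz
  obtain ⟨ρ₃, hρ₃, Q, hQ, hPQ, hQnear⟩ := h.exists_fiber_projection hX hPz
  obtain ⟨ρ₄, hρ₄, C', hC', htan⟩ := exists_tangent_intersection hX hY hisolated htransversal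
  set ρ := min (min ρ₁ ρ₂) (min ρ₃ ρ₄) with hρ
  have hρ0 : 0 < ρ := lt_min (lt_min h.ρ_pos hρ₂) (lt_min hρ₃ hρ₄)
  refine ⟨ball z ρ, ball_mem_nhds z hρ0, fun W hW hWρ => ?_⟩
  have hW₁ : W ⊆ ball z ρ₁ :=
    hWρ.trans (ball_subset_ball ((min_le_left _ _).trans (min_le_left _ _)))
  have hρρ₂ : ρ ≤ ρ₂ := (min_le_left _ _).trans (min_le_right _ _)
  have hW₃ : W ⊆ ball z ρ₃ :=
    hWρ.trans (ball_subset_ball ((min_le_right _ _).trans (min_le_left _ _)))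
  have hW₄ : W ⊆ ball z ρ₄ :=
    hWρ.trans (ball_subset_ball ((min_le_right _ _).trans (min_le_right _ _)))
  rintro _ rfl
  set M := P '' (X ∩ W) with hM
  have hzM : z ∈ M := ⟨z, ⟨hX.1, mem_of_mem_nhds hW⟩, hPz⟩
  have hMW : M ∩ W ⊆ P '' (X ∩ ball z ρ₃) ∩ ball z ρ₃ :=
    inter_subset_inter (image_mono (inter_subset_inter_right _ hW₃)) hW₃
  have hev : ∀ᶠ x in 𝓝[X] z, ∃ y ∈ Y ∩ W, y - x ∈ tangentSpace X x ∧
      dist y z ≤ C' * dist x z ^ 2 ∧ ∀ y' ∈ Y ∩ W, y' - x ∈ tangentSpace X x → y' = y := by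
    obtain ⟨η, hη, hηW⟩ := Metric.mem_nhds_iff.1 hW
    filter_upwards [self_mem_nhdsWithin, nhdsWithin_le_nhds (ball_mem_nhds z hη)] with x hxX hxη
    obtain ⟨y, hyY, h1, h2, h3, h4⟩ := htan x ⟨hxX, hW₄ (hηW hxη)⟩
    exact ⟨y, ⟨hyY, hηW (h3.trans_lt hxη)⟩, h1, h2, fun y' hy' => h4 y' ⟨hy'.1, hW₄ hy'.2⟩⟩
  refine ⟨⟨?_, h.isManifoldAround_image hX.1 hPz hW hW₁⟩, ?_, ?_, ?_, ?_, ?_, ?_, ?_, ?_, ?_⟩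
  · rintro _ ⟨x, hx, rfl⟩
    exact hPmaps hx.1
  · -- a map with the properties required here is the constant map `z`
    exact ⟨fun _ => z, fun _ _ => hzM, ⟨0, LipschitzOnWith.of_dist_le_mul fun _ _ _ _ => by simp⟩,
      rfl⟩
  · obtain ⟨V, hV, hVW, S, hS, hSnear⟩ := h.exists_local_projection_image hX hPz hW hW₁
    exact ⟨V, hV, hVW, S, hS.mono inter_subset_right, fun y hy => hSnear y hy.2⟩
  · rintro ⟨ε, hWε⟩
    obtain ⟨ε', h0, h1, h2⟩ := exists_closedBall_eq hρ0 (hWε ▸ hW) (hWε ▸ hWρ)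
    obtain ⟨S, hS, hSnear⟩ := hproj ε' h0 (h1.trans_le hρρ₂)
    rw [← h2, ← hWε] at hS hSnear
    exact ⟨S, hS.mono inter_subset_right, fun y hy => hSnear y hy.2⟩
  · exact ⟨Q, hQ.mono hMW, fun w hw => hPQ w (hMW hw)⟩
  · exact ⟨Q, hQ.mono hMW, fun w hw => hPQ w (hMW hw), fun w hw => hQnear w (hMW hw)⟩
  · rintro x ⟨hxX, hxW⟩ y ⟨hy, hyt⟩ y' ⟨hy', hyt'⟩
    obtain ⟨y₀, -, -, -, -, huniq⟩ := htan x ⟨hxX, hW₄ hxW⟩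
    exact (huniq y ⟨hy.1, hW₄ hy.2⟩ hyt).trans (huniq y' ⟨hy'.1, hW₄ hy'.2⟩ hyt').symm
  · filter_upwards [hev] with x hx
    obtain ⟨y, hy, hyt, -, huniq⟩ := hx
    exact ⟨y, ⟨hy, hyt⟩, fun y' hy' => huniq y' hy'.1 hy'.2⟩
  · rintro ⟨ε, hε⟩ x ⟨hxX, hxW⟩
    obtain ⟨y, hyY, hyt, -, hyx, huniq⟩ := htan x ⟨hxX, hW₄ hxW⟩
    have hyW : y ∈ W := by
      rcases hε with rfl | rfl
      · exact hyx.trans hxW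
      · exact hyx.trans_lt hxW
    exact ⟨y, ⟨⟨hyY, hyW⟩, hyt⟩, fun y' hy' => huniq y' ⟨hy'.1.1, hW₄ hy'.1.2⟩ hy'.2⟩
  · intro y S Q' hy V hV hVW hS hQ' _
    refine exists_quadratic_convergence (C := C') hY.1 hzM hW hV ?_ hS hQ'
    filter_upwards [hev, hy] with x hx hyx
    obtain ⟨y₀, -, -, hdist, huniq⟩ := hx
    exact ⟨hyx.1.1, hyx.2, huniq _ hyx.1 hyx.2 ▸ hdist⟩
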